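/- For a finite simple graph $G$ with vertex degrees $d_1,\dots,d_n$ and a real number $p\ge 1$, let $D_p(G)=\sum_{i=1}^n d_i^p$. Let $P_k$ be the path on $k$ vertices; a graph is $P_k$-free if it contains no (not necessarily induced) subgraph isomorphic to $P_k$. For integers $n,k,s\ge 0$ with $2s\le k$ and $k-s\le n$, let $W_{n,k,s}$ be the graph on $n$ vertices whose vertex set is partitioned into sets $X,Y,Z$ with $|X|=s$, $|Y|=k-2s$, $|Z|=n-(k-s)$, and whose edges are all pairs of distinct vertices in $X\cup Y$ and all pairs consisting of a vertex of $X$ and a vertex of $Z$. Theorem. Let $k\ge 4$ be an integer, let $p\ge 2$ be a real number, and let $n\ge 10k$ be an integer. If $G$ is an $n$-vertex $P_k$-free graph whose degree power sum $D_p(G)$ is maximum among all $n$-vertex $P_k$-free graphs, then $G$ is isomorphic to $W_{n,k-1,t}$, where $t=\lfloor k/2\rfloor-1$. -/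

import Mathlib

/-- The degree power sum `D_p(G) = ∑ v, d(v) ^ p` of a finite simple graph, for a real exponent `p`. -/
noncomputable def degreePowerSum {V : Type*} [Fintype V] (p : ℝ) (G : SimpleGraph V) : ℝ :=
  open Classical in ∑ v : V, (G.degree v : ℝ) ^ p

/-- `G` is free of the path on `k` vertices: no subgraph of `G` (induced or not) is such a path. -/
def PathFree {V : Type*} (k : ℕ) (G : SimpleGraph V) : Prop :=
  (SimpleGraph.pathGraph k).Free G

/-- `G` has the largest degree power sum among all graphs on the same vertex set that contain
no path on `k` vertices. -/
def IsMaxPathFree {V : Type*} [Fintype V] (k : ℕ) (p : ℝ) (G : SimpleGraph V) : Prop :=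
  PathFree k G ∧
    ∀ H : SimpleGraph V, PathFree k H → degreePowerSum p H ≤ degreePowerSum p G

/-- The graph `W_{n,k,s}` on the vertices `0, …, n - 1` (for `2 * s ≤ k` and `k - s ≤ n`).
The vertex set is split into `X = {i | i < s}`, `Y = {i | s ≤ i < k - s}` and `Z = {i | k - s ≤ i}`,
so that `|X| = s`, `|Y| = k - 2 * s` and `|Z| = n - (k - s)`. The edges are all pairs of distinct
vertices inside `X ∪ Y` and all pairs between `X` and `Z`. -/
def graphW (n k s : ℕ) : SimpleGraph (Fin n) where
  Adj i j := i ≠ j ∧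
    ((i.val < k - s ∧ j.val < k - s) ∨
      (i.val < s ∧ k - s ≤ j.val) ∨
      (k - s ≤ i.val ∧ j.val < s))
  symm := ⟨fun i j h => ⟨h.1.symm, by
    rcases h.2 with ⟨a, b⟩ | ⟨a, b⟩ | ⟨a, b⟩
    · exact Or.inl ⟨b, a⟩
    · exact Or.inr (Or.inr ⟨b, a⟩)
    · exact Or.inr (Or.inl ⟨b, a⟩)⟩⟩
  loopless := ⟨fun _ h => h.1 rfl⟩

/-! Write N = n - 1. The competitor `joinGraph T Y` with |T| = t is P_k-free, so its degree power
sum, at least t * N ^ p + (n - t) * t ^ p, is a lower bound for that of an extremal G. Since p-th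
powers are more convex than squares, and since a vertex outside the top t has degree at most 3N/5,
this bound implies its analogue for squares (`rpow_sub_rpow_le`, `sum_sq_sub_sq_le`), and p
disappears.

Let T hold the t largest degrees and let q be the total deficiency, the sum of N - d(x) over T.
Peeling off vertices of degree at most t leaves a core H whose inner degrees are at most k - 2, by a
longest path argument (`exists_peeling`, `degIn_add_two_le_of_no_path`). Double counting in
`exists_core` then gives N q ≤ (k - 2) q + E, where E is the total excess of squared inner degrees
in H over t ^ 2. As N is at least about 10k, q is small.

Vertices of degree at least 11n/20 pairwise have k common neighbours, so they can be strung on an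
alternating path. A path ending next to a set S of them must therefore have fewer than k - 2|S|
vertices. This limits E, and `exists_hubs` concludes that all of T consists of such hubs.

With t hubs, a path outside T that ends next to T has at most one vertex (k even) or two (k odd).
Each excess vertex is paid for by a vertex with no neighbour in T, up to a bounded error, while each
such vertex adds t to q; the inequality leaves none. So G - T has no edge, or for k odd at most one,
and G lies inside some `joinGraph T Y`. Strict monotonicity of the degree power sum gives equality.
-/

open scoped Classical in
/-- The number of neighbours of `v` inside the finite set `U`. -/
noncomputable def degIn {V : Type*} (G : SimpleGraph V) (U : Finset V) (v : V) : ℕ :=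
  (U.filter (G.Adj v)).card

/-- The list `l` enumerates the vertices of a path of `G` all of whose vertices are in `U`. -/
structure PathIn {V : Type*} (G : SimpleGraph V) (U : Finset V) (l : List V) : Prop where
  chain : l.IsChain G.Adj
  nodup : l.Nodup
  mem : ∀ v ∈ l, v ∈ U

/-! ### Paths as lists; closing a longest path into a cycle. -/

section Paths

open scoped Classical

variable {V : Type*} {G : SimpleGraph V} {U : Finset V} {l l₁ l₂ : List V} {v w : V} {k δ : ℕ}

theorem PathIn.infix (h : PathIn G U l) (hl : l₁ <:+: l) : PathIn G U l₁ :=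
  ⟨h.chain.infix hl, h.nodup.sublist hl.sublist, fun v hv => h.mem v (hl.subset hv)⟩

theorem PathIn.mono {W : Finset V} (h : PathIn G U l) (hU : U ⊆ W) : PathIn G W l :=
  ⟨h.chain, h.nodup, fun v hv => hU (h.mem v hv)⟩

theorem PathIn.reverse (h : PathIn G U l) : PathIn G U l.reverse :=
  ⟨List.isChain_reverse.2 (h.chain.imp fun _ _ hab => hab.symm), List.nodup_reverse.2 h.nodup,
    fun v hv => h.mem v (List.mem_reverse.1 hv)⟩

theorem PathIn.nil : PathIn G U [] := ⟨List.IsChain.nil, List.nodup_nil, by simp⟩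

theorem PathIn.singleton (h : v ∈ U) : PathIn G U [v] :=
  ⟨List.IsChain.singleton v, List.nodup_singleton v, by simpa using h⟩

theorem PathIn.append (h₁ : PathIn G U l₁) (h₂ : PathIn G U l₂)
    (h : ∀ x ∈ l₁.getLast?, ∀ y ∈ l₂.head?, G.Adj x y) (hd : ∀ x ∈ l₁, x ∉ l₂) :
    PathIn G U (l₁ ++ l₂) :=
  ⟨List.isChain_append.2 ⟨h₁.chain, h₂.chain, h⟩,
    List.nodup_append.2 ⟨h₁.nodup, h₂.nodup, fun a ha b hb hab => hd a ha (hab ▸ hb)⟩, by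
    intro v hv
    rcases List.mem_append.1 hv with hv | hv
    exacts [h₁.mem v hv, h₂.mem v hv]⟩

theorem PathIn.cons (h : PathIn G U l) (hv : v ∈ U) (hvl : v ∉ l)
    (hadj : ∀ y ∈ l.head?, G.Adj v y) : PathIn G U (v :: l) :=
  (PathIn.singleton hv).append h (by simpa using hadj) (by simpa using hvl)

theorem PathIn.length_lt (hno : ∀ l, PathIn G U l → l.length ≠ k) (h : PathIn G U l) :
    l.length < k := by
  by_contra hc
  exact hno _ (h.infix (List.take_prefix k l).isInfix) (by simp; omega)

theorem PathIn.card_toFinset (h : PathIn G U l) : l.toFinset.card = l.length :=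
  List.toFinset_card_of_nodup h.nodup

/-- A path whose ends are adjacent can be rotated to start at any of its vertices. -/
theorem PathIn.exists_rotate (h : PathIn G U l)
    (hc : ∀ x ∈ l.getLast?, ∀ y ∈ l.head?, G.Adj x y) (hv : v ∈ l) :
    ∃ l', PathIn G U (v :: l') ∧ l'.length + 1 = l.length ∧ ∀ x, x ∈ v :: l' ↔ x ∈ l := by
  obtain ⟨X, Y, rfl⟩ := List.append_of_mem hv
  refine ⟨Y ++ X, ?_, by simp; omega, by intro x; simp; tauto⟩
  have h1 : PathIn G U (v :: Y) := h.infix (List.suffix_append X _).isInfix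
  have h2 : PathIn G U X := h.infix (List.prefix_append X _).isInfix
  have h3 := List.nodup_append.1 h.nodup
  refine h1.append h2 ?_ fun x hx hx' => h3.2.2 x hx' x hx rfl
  intro x hx y hy
  refine hc x ?_ y ?_
  · rw [List.getLast?_append]
    simp only [Option.mem_def] at hx ⊢
    rw [hx]; rfl
  · rw [List.head?_append]
    simp only [Option.mem_def] at hy ⊢
    rw [hy]; rfl

/-- If every neighbour of each end of a path lies on the path and both ends have large degree,
then the vertices of the path carry a cycle. -/
theorem PathIn.exists_cycle (h : PathIn G U l) (hne : l ≠ [])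
    (ha : ∀ x ∈ U, G.Adj (l.head hne) x → x ∈ l) (hb : ∀ x ∈ U, G.Adj (l.getLast hne) x → x ∈ l)
    (hda : δ ≤ degIn G U (l.head hne)) (hdb : δ ≤ degIn G U (l.getLast hne))
    (hl : l.length ≤ 2 * δ) :
    ∃ l', PathIn G U l' ∧ l'.length = l.length ∧ (∀ x, x ∈ l' ↔ x ∈ l) ∧
      ∀ x ∈ l'.getLast?, ∀ y ∈ l'.head?, G.Adj x y := by
  set m := l.length with hm
  have hmpos : 0 < m := List.length_pos_of_ne_nil hne
  have hhead : l.head hne = l[0] := List.head_eq_getElem hne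
  have hlast : l.getLast hne = l[m - 1] := List.getLast_eq_getElem hne
  -- Crossing chords: i lies in A if the first vertex sees l[i + 1], in B if the last sees l[i].
  -- Both sets have at least δ elements among m - 1 < 2 * δ positions, so they meet.
  set A := (Finset.range (m - 1)).filter fun i => ∃ hi : i + 1 < m, G.Adj l[0] l[i + 1] with hA
  set B := (Finset.range (m - 1)).filter fun i => ∃ hi : i < m, G.Adj l[m - 1] l[i] with hB
  have hAc : δ ≤ A.card := by
    refine hda.trans ?_
    unfold degIn
    refine Finset.card_le_card_of_surjOn (fun i => if hi : i + 1 < m then l[i + 1] else l[0]) ?_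
    intro x hx
    simp only [Finset.coe_filter, Set.mem_ofPred_eq] at hx
    obtain ⟨j, hj, rfl⟩ := List.getElem_of_mem (ha x hx.1 hx.2)
    rcases j with _ | j
    · rw [hhead] at hx; exact absurd hx.2 (G.loopless.irrefl _)
    · refine ⟨j, ?_, by simp only [dif_pos (show j + 1 < m from hj)]⟩
      simp only [hA, Finset.coe_filter, Set.mem_ofPred_eq, Finset.mem_range]
      exact ⟨by omega, hj, hhead ▸ hx.2⟩
  have hBc : δ ≤ B.card := by
    refine hdb.trans ?_
    unfold degIn
    refine Finset.card_le_card_of_surjOn (fun i => if hi : i < m then l[i] else l[0]) ?_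
    intro x hx
    simp only [Finset.coe_filter, Set.mem_ofPred_eq] at hx
    obtain ⟨j, hj, rfl⟩ := List.getElem_of_mem (hb x hx.1 hx.2)
    refine ⟨j, ?_, by simp only [dif_pos (show j < m from hj)]⟩
    simp only [hB, Finset.coe_filter, Set.mem_ofPred_eq, Finset.mem_range]
    refine ⟨?_, hj, hlast ▸ hx.2⟩
    by_contra hc
    have : j = m - 1 := by omega
    subst this
    rw [hlast] at hx; exact absurd hx.2 (G.loopless.irrefl _)
  have hAB : ¬ Disjoint A B := by
    intro hd
    have h1 := Finset.card_union_of_disjoint hd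
    have h2 : (A ∪ B).card ≤ (Finset.range (m - 1)).card :=
      Finset.card_le_card (Finset.union_subset (Finset.filter_subset _ _)
        (Finset.filter_subset _ _))
    rw [Finset.card_range] at h2
    omega
  obtain ⟨i, hiA, hiB⟩ := Finset.not_disjoint_iff.1 hAB
  simp only [hA, Finset.mem_filter] at hiA
  simp only [hB, Finset.mem_filter] at hiB
  obtain ⟨-, hi1, hadj1⟩ := hiA
  obtain ⟨-, hi0, hadj0⟩ := hiB
  have hsplit : l.take (i + 1) ++ l.drop (i + 1) = l := List.take_append_drop _ _
  have hd1 : l.drop (i + 1) ≠ [] := by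
    intro h0; have := congrArg List.length h0; simp at this; omega
  have hnd := List.nodup_append.1 (hsplit.symm ▸ h.nodup)
  have hdropLast : (l.drop (i + 1)).getLast? = some l[m - 1] := by
    rw [List.getLast?_eq_some_getLast hd1, List.getLast_drop, hlast]
  have hdropHead : (l.drop (i + 1)).head? = some l[i + 1] := by
    rw [List.head?_drop]; exact List.getElem?_eq_getElem hi1
  -- The two chords replace the edge between positions i and i + 1: run to l[i], jump to the last
  -- vertex, return to l[i + 1], close up at l[0].
  refine ⟨l.take (i + 1) ++ (l.drop (i + 1)).reverse, ?_, by simp; omega, ?_, ?_⟩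
  · refine (h.infix (List.take_prefix _ _).isInfix).append
      (h.infix (List.drop_suffix _ _).isInfix).reverse ?_ ?_
    · intro x hx y hy
      rw [List.head?_reverse, hdropLast] at hy
      rw [List.getLast?_take] at hx
      simp only [Nat.add_eq_zero_iff, one_ne_zero, and_false, ↓reduceIte, Nat.add_sub_cancel,
        List.getElem?_eq_getElem hi0, Option.mem_def] at hx hy
      simp only [Option.some_or, Option.some.injEq] at hx hy
      subst hx hy
      exact hadj0.symm
    · intro x hx hx'
      exact hnd.2.2 x hx x (List.mem_reverse.1 hx') rfl
  · intro x
    conv_rhs => rw [← hsplit]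
    simp only [List.mem_append, List.mem_reverse]
  · intro x hx y hy
    rw [List.getLast?_append, List.getLast?_reverse, hdropHead] at hx
    rw [List.head?_append, List.head?_take] at hy
    simp only [Nat.add_eq_zero_iff, one_ne_zero, and_false, ↓reduceIte, Option.mem_def,
      Option.some_or, Option.some.injEq, List.head?_eq_some_head hne, hhead] at hx hy
    subst hx hy
    exact hadj1.symm

/-- In a finite set of vertices without a path on `k` vertices, all inner degrees being at least
`(k - 1) / 2` forces them to be at most `k - 2`. -/
theorem degIn_add_two_le_of_no_path (hδ : ∀ v ∈ U, δ ≤ degIn G U v) (hk : k ≤ 2 * δ + 1)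
    (hno : ∀ l, PathIn G U l → l.length ≠ k) (hv : v ∈ U) : degIn G U v + 2 ≤ k := by
  by_contra hcon
  set r : V → V → Prop := fun a b => G.Adj a b ∧ a ∈ U ∧ b ∈ U with hr
  have hsymm : ∀ a b, r a b → r b a := fun a b hab => ⟨hab.1.symm, hab.2.2, hab.2.1⟩
  -- K is the component of v in U. A longest path in K closes into a cycle; by connectedness the
  -- cycle covers K, so K has fewer than k vertices.
  set K := U.filter (Relation.ReflTransGen r v) with hK
  have hKU : K ⊆ U := Finset.filter_subset _ _
  have hclosed : ∀ a ∈ K, ∀ b ∈ U, G.Adj a b → b ∈ K := by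
    intro a ha b hb hab
    rw [hK, Finset.mem_filter] at ha ⊢
    exact ⟨hb, ha.2.tail ⟨hab, ha.1, hb⟩⟩
  have hvK : v ∈ K := Finset.mem_filter.2 ⟨hv, Relation.ReflTransGen.refl⟩
  have hdeg : ∀ a ∈ K, degIn G U a = degIn G K a := by
    intro a ha
    unfold degIn
    congr 1
    ext b
    simp only [Finset.mem_filter]
    exact ⟨fun hb => ⟨hclosed a ha b hb.1 hb.2, hb.2⟩, fun hb => ⟨hKU hb.1, hb.2⟩⟩
  have hlt : ∀ l, PathIn G K l → l.length < k :=
    fun l hl => PathIn.length_lt hno (hl.mono hKU)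
  obtain ⟨l, hl, hmax⟩ : ∃ l, PathIn G K l ∧ ∀ l', PathIn G K l' → l'.length ≤ l.length := by
    let P : ℕ → Prop := fun m => ∃ l, PathIn G K l ∧ l.length = m
    have h0 : P 0 := ⟨[], PathIn.nil, rfl⟩
    obtain ⟨l, hl, hlen⟩ := Nat.findGreatest_spec (P := P) (Nat.zero_le k) h0
    exact ⟨l, hl, fun l' hl' => hlen ▸ Nat.le_findGreatest (hlt l' hl').le ⟨l', hl', rfl⟩⟩
  have hne : l ≠ [] := by
    rintro rfl
    have := hmax [v] (PathIn.singleton hvK)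
    simp at this
  have hlk := hlt l hl
  obtain ⟨l', hl', hlen, hmem, hcyc⟩ := hl.exists_cycle hne (δ := δ) (by
      intro x hx hadj
      by_contra hxl
      have := hmax _ (hl.cons hx hxl (by
        rw [List.head?_eq_some_head hne]; simpa using hadj.symm))
      simp at this) (by
      intro x hx hadj
      by_contra hxl
      have := hmax _ (hl.reverse.cons hx (by simpa using hxl) (by
        rw [List.head?_reverse, List.getLast?_eq_some_getLast hne]; simpa using hadj.symm))
      simp at this)
      (by
        have := hl.mem _ (List.head_mem hne)
        rw [← hdeg _ this]; exact hδ _ (hKU this))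
      (by
        have := hl.mem _ (List.getLast_mem hne)
        rw [← hdeg _ this]; exact hδ _ (hKU this)) (by omega)
  -- An edge leaving the cycle, prefixed to the cycle cut open at y, would give a longer path.
  have hout : ∀ y ∈ l, ∀ x ∈ K, G.Adj y x → x ∈ l := by
    intro y hy x hx hadj
    by_contra hxl
    obtain ⟨l'', h1, h2, h3⟩ := hl'.exists_rotate hcyc ((hmem y).2 hy)
    have := hmax _ (h1.cons hx (fun hx' => hxl ((hmem x).1 ((h3 x).1 hx')))
      (by simpa using hadj.symm))
    simp only [List.length_cons] at this
    omega
  have hall : ∀ y, Relation.ReflTransGen r v y → (y ∈ l ↔ v ∈ l) := by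
    intro y hy
    induction hy with
    | refl => rfl
    | @tail b c hvb hbc ih =>
      have hbK : b ∈ K := Finset.mem_filter.2 ⟨hbc.2.1, hvb⟩
      have hcK : c ∈ K := hclosed b hbK c hbc.2.2 hbc.1
      rw [← ih]
      exact ⟨fun h => hout c h b hbK hbc.1.symm, fun h => hout b h c hcK hbc.1⟩
  have hvl : v ∈ l := by
    have h1 := hl.mem _ (List.head_mem hne)
    exact (hall _ (Finset.mem_filter.1 h1).2).1 (List.head_mem hne)
  have hKl : K ⊆ l.toFinset := fun y hy =>
    List.mem_toFinset.2 ((hall y (Finset.mem_filter.1 hy).2).2 hvl)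
  have hcard := Finset.card_le_card hKl
  rw [hl.card_toFinset] at hcard
  have hins : insert v (K.filter (G.Adj v)) ⊆ K :=
    Finset.insert_subset hvK (Finset.filter_subset _ _)
  have hc2 := Finset.card_le_card hins
  rw [Finset.card_insert_of_notMem (by simp)] at hc2
  rw [hdeg v hvK] at hcon
  unfold degIn at hcon
  omega

end Paths

/-! ### Deleting vertices of small degree: Erdős–Gallai and peeling. -/

section Degrees

open scoped Classical

variable {V : Type*} {G : SimpleGraph V} {U : Finset V} {v w : V} {k t : ℕ}

theorem degIn_add_one_le_card (hv : v ∈ U) : degIn G U v + 1 ≤ U.card := by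
  have h : insert v (U.filter (G.Adj v)) ⊆ U := Finset.insert_subset hv (Finset.filter_subset _ _)
  have := Finset.card_le_card h
  rwa [Finset.card_insert_of_notMem (by simp)] at this

theorem degIn_eq_erase_add (hv : v ∈ U) (w : V) :
    degIn G U w = degIn G (U.erase v) w + if G.Adj w v then 1 else 0 := by
  unfold degIn
  rw [Finset.filter_erase]
  split_ifs with h
  · rw [Finset.card_erase_add_one (Finset.mem_filter.2 ⟨hv, h⟩)]
  · rw [Finset.erase_eq_of_notMem (by simp [h]), add_zero]

theorem sum_erase_adj (v : V) :
    ∑ w ∈ U.erase v, (if G.Adj w v then 1 else 0) = degIn G U v := by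
  rw [← Finset.card_filter]
  unfold degIn
  congr 1
  ext w
  simp only [Finset.mem_filter, Finset.mem_erase, G.adj_comm w v]
  exact ⟨fun h => ⟨h.1.2, h.2⟩, fun h => ⟨⟨h.2.ne', h.1⟩, h.2⟩⟩

/-- The Erdős–Gallai bound for paths. -/
theorem sum_degIn_le (hno : ∀ l, PathIn G U l → l.length ≠ k) :
    ∑ v ∈ U, degIn G U v ≤ (k - 2) * U.card := by
  induction hn : U.card generalizing U with
  | zero => rw [Finset.card_eq_zero.1 hn]; simp
  | succ n ih =>
    -- Deleting such a vertex lowers the degree sum by twice its degree, at most k - 2. If none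
    -- exists, all degrees are at least k / 2, hence at most k - 2.
    by_cases h : ∃ v ∈ U, 2 * degIn G U v + 2 ≤ k
    · obtain ⟨v, hv, hvk⟩ := h
      have h1 := ih (U := U.erase v)
        (fun l hl => hno l (hl.mono (Finset.erase_subset _ _))) (by
          rw [Finset.card_erase_of_mem hv, hn]; rfl)
      have h2 : ∑ w ∈ U.erase v, degIn G U w =
          ∑ w ∈ U.erase v, degIn G (U.erase v) w + degIn G U v := by
        rw [← sum_erase_adj (U := U) v, ← Finset.sum_add_distrib]
        exact Finset.sum_congr rfl fun w _ => degIn_eq_erase_add hv w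
      rw [← Finset.add_sum_erase _ _ hv, h2, mul_add, mul_one]
      omega
    · push Not at h
      rw [← hn, mul_comm, ← smul_eq_mul, ← Finset.sum_const]
      refine Finset.sum_le_sum fun v hv => ?_
      have := degIn_add_two_le_of_no_path (δ := k / 2)
        (fun w hw => by have := h w hw; omega) (by omega) hno hv
      omega

/-- Successive deletion of vertices of degree at most `t` leaves a set `H`; the degree of `v`
splits into the number `b v` of neighbours present when `v` is deleted (or in `H`) and the number
`f v` of neighbours deleted before. -/
theorem exists_peeling (hk : k ≤ 2 * (t + 1) + 1) (htk : t + 2 ≤ k)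
    (hno : ∀ l, PathIn G U l → l.length ≠ k) (hU : t + 1 ≤ U.card) :
    ∃ H ⊆ U, ∃ f b : V → ℕ, (∀ v ∈ U, degIn G U v = f v + b v) ∧
      (∀ v ∈ H, b v = degIn G H v) ∧ (∀ v ∈ H, b v + 2 ≤ k) ∧ (∀ v ∈ U, v ∉ H → b v ≤ t) ∧
      t + 1 ≤ H.card ∧ ∑ v ∈ U, f v + t * H.card ≤ t * U.card := by
  induction hn : U.card generalizing U with
  | zero => omega
  | succ n ih =>
    -- Stopping at t + 1 vertices keeps |H| ≥ t + 1; inner degrees there are at most t ≤ k - 2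
    -- trivially.
    by_cases hbase : U.card = t + 1
    · refine ⟨U, subset_rfl, fun _ => 0, degIn G U, by simp, by simp, ?_, by simp_all, hU, ?_⟩
      · intro v hv
        have := degIn_add_one_le_card (G := G) hv
        omega
      · simp [hn]
    by_cases h : ∃ v ∈ U, degIn G U v ≤ t
    · obtain ⟨v, hv, hvt⟩ := h
      have hc : (U.erase v).card = n := by rw [Finset.card_erase_of_mem hv, hn]; rfl
      obtain ⟨H, hHU, f, b, h1, h2, h3, h4, h5, h6⟩ := ih (U := U.erase v)
        (fun l hl => hno l (hl.mono (Finset.erase_subset _ _))) (by omega) hc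
      have hvH : v ∉ H := fun hvH => by simpa using hHU hvH
      refine ⟨H, hHU.trans (Finset.erase_subset _ _),
        -- The vertex v is the first one deleted, so it precedes all its neighbours in the deletion
        -- order.
        fun w => if w = v then 0 else f w + if G.Adj w v then 1 else 0,
        fun w => if w = v then degIn G U v else b w, ?_, ?_, ?_, ?_, h5, ?_⟩
      · intro w hw
        by_cases hwv : w = v
        · simp [hwv]
        · have := h1 w (Finset.mem_erase.2 ⟨hwv, hw⟩)
          have h' := degIn_eq_erase_add (G := G) hv w
          simp only [if_neg hwv]
          omega
      · intro w hw
        have hwv : w ≠ v := fun h => hvH (h ▸ hw)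
        simpa only [if_neg hwv] using h2 w hw
      · intro w hw
        have hwv : w ≠ v := fun h => hvH (h ▸ hw)
        simpa only [if_neg hwv] using h3 w hw
      · intro w hw hwH
        by_cases hwv : w = v
        · simpa [hwv] using hvt
        · simpa only [if_neg hwv] using h4 w (Finset.mem_erase.2 ⟨hwv, hw⟩) hwH
      · rw [← Finset.add_sum_erase _ _ hv, if_pos rfl, zero_add]
        have : ∑ w ∈ U.erase v, (if w = v then 0 else f w + if G.Adj w v then 1 else 0) =
            ∑ w ∈ U.erase v, f w + degIn G U v := by
          rw [← sum_erase_adj (U := U) v, ← Finset.sum_add_distrib]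
          exact Finset.sum_congr rfl fun w hw => if_neg (Finset.ne_of_mem_erase hw)
        rw [this, mul_add, mul_one]
        omega
    · push Not at h
      refine ⟨U, subset_rfl, fun _ => 0, degIn G U, by simp, by simp, ?_, by simp_all, hU, ?_⟩
      · exact fun v hv => degIn_add_two_le_of_no_path (δ := t + 1) h hk hno hv
      · simp [hn]

end Degrees

/-! ### Stringing vertices with many common neighbours on a path. -/

section Linking

open scoped Classical

variable {V : Type*} [Fintype V] {G : SimpleGraph V} {k : ℕ}

/-- Vertices with large pairwise common neighbourhoods can be linked into an alternating path. -/
theorem exists_link (l : List V) (hnd : l.Nodup)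
    (hcod : ∀ x ∈ l, ∀ y ∈ l, k ≤ (Finset.univ.filter fun z => G.Adj x z ∧ G.Adj y z).card)
    (hne : l ≠ []) (F : Finset V) (hF : ∀ x ∈ l, x ∉ F) (hcard : F.card + 2 * l.length ≤ k + 1) :
    ∃ l', PathIn G Finset.univ l' ∧ l'.head? = l.head? ∧ l'.getLast? = l.getLast? ∧
      l'.length + 1 = 2 * l.length ∧ ∀ x ∈ l', x ∉ F := by
  induction l generalizing F with
  | nil => exact absurd rfl hne
  | cons x l ih =>
    rcases l with _ | ⟨y, l⟩
    · exact ⟨[x], PathIn.singleton (Finset.mem_univ _), rfl, rfl, rfl, hF⟩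
    -- With at least two vertices in the list, the budget leaves fewer than k forbidden vertices, so
    -- some common neighbour is free. Forbidding x and z afterwards costs 2, just what the shorter
    -- list releases.
    obtain ⟨z, hz, hz'⟩ : ∃ z ∈ Finset.univ.filter (fun z => G.Adj x z ∧ G.Adj y z),
        z ∉ F ∪ (x :: y :: l).toFinset := by
      refine Finset.exists_mem_notMem_of_card_lt_card ?_
      refine lt_of_lt_of_le ?_ (hcod x (by simp) y (by simp))
      have h1 := Finset.card_union_le F (x :: y :: l).toFinset
      have h2 := List.toFinset_card_le (x :: y :: l)
      simp only [List.length_cons] at h2 hcard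
      omega
    simp only [Finset.mem_filter, Finset.mem_univ, true_and] at hz
    simp only [Finset.mem_union, List.mem_toFinset, not_or] at hz'
    have hnd' := List.nodup_cons.1 hnd
    obtain ⟨l', h1, h2, h3, h4, h5⟩ := ih hnd'.2
      (fun a ha b hb => hcod a (List.mem_cons_of_mem _ ha) b (List.mem_cons_of_mem _ hb))
      (by simp) (insert x (insert z F)) (by
        intro a ha hmem
        simp only [Finset.mem_insert] at hmem
        rcases hmem with rfl | rfl | hmem
        · exact hnd'.1 ha
        · exact hz'.2 (List.mem_cons_of_mem _ ha)
        · exact hF a (List.mem_cons_of_mem _ ha) hmem) (by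
        have := Finset.card_insert_le x (insert z F)
        have := Finset.card_insert_le z F
        simp only [List.length_cons] at hcard ⊢
        omega)
    refine ⟨x :: z :: l', ?_, rfl, ?_, by simp only [List.length_cons] at h4 ⊢; omega, ?_⟩
    · refine (h1.cons (Finset.mem_univ z) (fun h => h5 z h (by simp)) ?_).cons
        (Finset.mem_univ x) ?_ (by simpa using hz.1)
      · rw [h2]; simpa using hz.2.symm
      · rw [List.mem_cons, not_or]
        exact ⟨hz.1.ne, fun h => h5 x h (by simp)⟩
    · have hl' : l' ≠ [] := by rintro rfl; simp at h2
      rw [List.getLast?_cons_cons, List.getLast?_cons_cons, ← h3]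
      obtain ⟨a, l'', rfl⟩ := List.exists_cons_of_ne_nil hl'
      rw [List.getLast?_cons_cons]
    · intro a ha
      simp only [List.mem_cons] at ha
      rcases ha with rfl | rfl | ha
      · exact hF _ (by simp)
      · exact hz'.1
      · intro haF
        exact h5 a ha (by simp [haF])

/-- Two disjoint paths can be joined by an alternating path through all vertices of `l`. -/
theorem exists_path_through {l Q₁ Q₂ : List V} (hnd : l.Nodup)
    (hcod : ∀ x ∈ l, ∀ y ∈ l, k ≤ (Finset.univ.filter fun z => G.Adj x z ∧ G.Adj y z).card)
    (hne : l ≠ []) (h₁ : PathIn G Finset.univ Q₁) (h₂ : PathIn G Finset.univ Q₂)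
    (h₁l : ∀ x ∈ l, x ∉ Q₁) (h₂l : ∀ x ∈ l, x ∉ Q₂) (h₁₂ : ∀ x ∈ Q₁, x ∉ Q₂)
    (hadj₁ : ∀ x ∈ Q₁.getLast?, ∀ y ∈ l.head?, G.Adj x y)
    (hadj₂ : ∀ x ∈ l.getLast?, ∀ y ∈ Q₂.head?, G.Adj x y)
    (hcard : Q₁.length + Q₂.length + 2 * l.length ≤ k + 1) :
    ∃ l', PathIn G Finset.univ l' ∧ l'.length + 1 = Q₁.length + Q₂.length + 2 * l.length := by
  obtain ⟨l', h1, h2, h3, h4, h5⟩ := exists_link l hnd hcod hne (Q₁.toFinset ∪ Q₂.toFinset)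
    (by
      intro x hx
      simpa only [Finset.mem_union, List.mem_toFinset, not_or] using ⟨h₁l x hx, h₂l x hx⟩)
    (by
      have := Finset.card_union_le Q₁.toFinset Q₂.toFinset
      have := List.toFinset_card_le Q₁
      have := List.toFinset_card_le Q₂
      omega)
  simp only [Finset.mem_union, List.mem_toFinset, not_or] at h5
  refine ⟨Q₁ ++ (l' ++ Q₂), ?_, by simp only [List.length_append]; omega⟩
  refine h₁.append (h1.append h₂ (by rwa [h3]) fun x hx => (h5 x hx).2) ?_ ?_
  · intro x hx y hy
    refine hadj₁ x hx y ?_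
    have hl' : l' ≠ [] := by
      rintro rfl
      rw [List.head?_eq_some_head hne] at h2
      simp at h2
    rw [List.head?_append, h2, List.head?_eq_some_head hne] at hy
    rw [List.head?_eq_some_head hne]
    simpa using hy
  · intro x hx hx'
    rcases List.mem_append.1 hx' with hx' | hx'
    · exact (h5 x hx').1 hx
    · exact h₁₂ x hx hx'

/-- A path ending next to the first vertex of `l` extends through all vertices of `l` and one
vertex more. -/
theorem exists_path_tail {l Q : List V} (hnd : l.Nodup)
    (hcod : ∀ x ∈ l, ∀ y ∈ l, k ≤ (Finset.univ.filter fun z => G.Adj x z ∧ G.Adj y z).card)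
    (hne : l ≠ []) (hQ : PathIn G Finset.univ Q) (hQl : ∀ x ∈ l, x ∉ Q)
    (hadj : ∀ x ∈ Q.getLast?, ∀ y ∈ l.head?, G.Adj x y)
    (hcard : Q.length + 2 * l.length ≤ k) :
    ∃ l', PathIn G Finset.univ l' ∧ l'.length = Q.length + 2 * l.length := by
  have hlast := List.getLast_mem hne
  obtain ⟨z, hz, hz'⟩ : ∃ z ∈ Finset.univ.filter
      (fun z => G.Adj (l.getLast hne) z ∧ G.Adj (l.getLast hne) z),
      z ∉ Q.toFinset ∪ l.toFinset := by
    refine Finset.exists_mem_notMem_of_card_lt_card ?_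
    refine lt_of_lt_of_le ?_ (hcod _ hlast _ hlast)
    have := Finset.card_union_le Q.toFinset l.toFinset
    have := List.toFinset_card_le Q
    have := List.toFinset_card_le l
    have := List.length_pos_of_ne_nil hne
    omega
  simp only [Finset.mem_filter, Finset.mem_univ, true_and, and_self] at hz
  simp only [Finset.mem_union, List.mem_toFinset, not_or] at hz'
  obtain ⟨l', h1, h2⟩ := exists_path_through hnd hcod hne hQ
    (PathIn.singleton (Finset.mem_univ z)) hQl
    (fun x hx hxz => hz'.2 (by simp only [List.mem_singleton] at hxz; exact hxz ▸ hx))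
    (fun x hx hxz => hz'.1 (by simp only [List.mem_singleton] at hxz; exact hxz ▸ hx)) hadj
    (by rw [List.getLast?_eq_some_getLast hne]; simpa using hz)
    (by simp only [List.length_singleton]; omega)
  exact ⟨l', h1, by simp only [List.length_singleton] at h2; omega⟩

end Linking

/-! ### Path-freeness in terms of lists. -/

section PathFree

open scoped Classical

variable {V : Type*} [Fintype V] {G : SimpleGraph V} {k : ℕ}

theorem pathFree_iff : PathFree k G ↔ ∀ l, PathIn G Finset.univ l → l.length ≠ k := by
  unfold PathFree SimpleGraph.Free
  constructor
  · rintro h l hl rfl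
    refine h ⟨⟨⟨fun i => l[i.val], ?_⟩, fun i j hij => ?_⟩⟩
    · intro i j hij
      have hc := List.isChain_iff_getElem.1 hl.chain
      rcases SimpleGraph.pathGraph_adj.1 hij with hij | hij
      · have := hc i (by omega)
        simpa only [hij] using this
      · have := hc j (by omega)
        simpa only [hij] using this.symm
    · exact Fin.ext ((List.Nodup.getElem_inj_iff hl.nodup).1 hij)
  · rintro h ⟨f⟩
    refine h (List.ofFn f) ⟨?_, List.nodup_ofFn.2 f.injective, by simp⟩ (by simp)
    rw [List.isChain_ofFn]
    intro i hi
    exact f.toHom.map_adj (SimpleGraph.pathGraph_adj.2 (Or.inl rfl))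

end PathFree

/-! ### The competitor graph: path-freeness and isomorphism with `graphW`. -/

/-- The join of a clique on `T` with the disjoint union of a clique on `Y` and isolated vertices. -/
def joinGraph {V : Type*} (T Y : Finset V) : SimpleGraph V where
  Adj i j := i ≠ j ∧ (i ∈ T ∨ j ∈ T ∨ (i ∈ Y ∧ j ∈ Y))
  symm := ⟨fun _ _ h => ⟨h.1.symm, by tauto⟩⟩
  loopless := ⟨fun _ h => h.1 rfl⟩

section JoinGraph

open scoped Classical

variable {V : Type*} {T Y : Finset V}

/-- The vertices of T cut the path into at most one more block than their number, and a block with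
two or more vertices lies in Y. Starting in T saves one block; this second bound is what the
induction needs. -/
theorem length_le_of_isChain_joinGraph (l : List V) (hl : l.IsChain (joinGraph T Y).Adj) :
    l.length ≤ 2 * l.countP (· ∈ T) + 1 + (l.countP (· ∈ Y) - 1) ∧
      ∀ x ∈ l.head?, x ∈ T → l.length ≤ 2 * l.countP (· ∈ T) + (l.countP (· ∈ Y) - 1) := by
  induction l with
  | nil => simp
  | cons a l ih =>
    obtain ⟨hhead, hl'⟩ := List.isChain_cons.1 hl
    obtain ⟨ih1, ih2⟩ := ih hl'
    simp only [List.countP_cons, List.length_cons, List.head?_cons, Option.mem_def,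
      Option.some.injEq, forall_eq', decide_eq_true_eq]
    by_cases haT : a ∈ T
    · simp only [haT, if_true]
      split_ifs <;> constructor <;> intros <;> omega
    · simp only [haT, if_false, false_imp_iff, and_true]
      rcases l with _ | ⟨b, l⟩
      · simp
      have hab := hhead b rfl
      by_cases hbT : b ∈ T
      · have := ih2 b rfl hbT
        split_ifs <;> omega
      · have hY : a ∈ Y ∧ b ∈ Y := by
          rcases hab.2 with h | h | h
          exacts [absurd h haT, absurd h hbT, h]
        simp only [hY.1, if_true]
        have : 1 ≤ (b :: l).countP (· ∈ Y) := by
          rw [List.countP_cons]; simp [hY.2]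
        omega

theorem countP_mem_le_card {l : List V} (hl : l.Nodup) (S : Finset V) :
    l.countP (· ∈ S) ≤ S.card := by
  rw [List.countP_eq_length_filter, ← List.toFinset_card_of_nodup (hl.filter _)]
  refine Finset.card_le_card fun x hx => ?_
  simpa using (List.mem_filter.1 (List.mem_toFinset.1 hx)).2

variable [Fintype V]

theorem pathFree_joinGraph {k : ℕ} (hk : 2 * T.card + Y.card < k) (hY : 0 < Y.card) :
    PathFree k (joinGraph T Y) := by
  rw [pathFree_iff]
  intro l hl hlen
  have h1 := (length_le_of_isChain_joinGraph l hl.chain).1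
  have h2 := countP_mem_le_card hl.nodup T
  have h3 := countP_mem_le_card hl.nodup Y
  omega

theorem card_filter_fin_lt {n a : ℕ} (h : a ≤ n) :
    (Finset.univ.filter fun i : Fin n => i.val < a).card = a := by
  rw [Fin.card_filter_val_lt, min_eq_right h]

theorem nonempty_joinGraph_iso {n m : ℕ} (hV : Fintype.card V = n) (hm : 2 * T.card ≤ m)
    (hY : Y.card = m - 2 * T.card) (hTY : Disjoint T Y) :
    Nonempty (joinGraph T Y ≃g graphW n m T.card) := by
  set t := T.card with ht
  have hn : m - t ≤ n := by
    have h1 := Finset.card_le_univ (T ∪ Y)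
    rw [Finset.card_union_of_disjoint hTY] at h1
    omega
  -- Adjacency of distinct vertices depends only on their classes on both sides, so a bijection
  -- matching the three classes, which have equal sizes, is an isomorphism.
  let f : V → Fin 3 := fun v => if v ∈ T then 0 else if v ∈ Y then 1 else 2
  let g : Fin n → Fin 3 := fun i => if i.val < t then 0 else if i.val < m - t then 1 else 2
  have hf : ∀ v, (f v = 0 ↔ v ∈ T) ∧ (f v = 1 ↔ v ∈ Y) := by
    intro v
    by_cases h1 : v ∈ T
    · have h2 := Finset.disjoint_left.1 hTY h1
      simp [f, h1, h2]
    · by_cases h2 : v ∈ Y <;> simp [f, h1, h2]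
  have hg : ∀ i, (g i = 0 ↔ i.val < t) ∧ (g i = 1 ↔ t ≤ i.val ∧ i.val < m - t) := by
    intro i
    by_cases h1 : i.val < t
    · simp [g, h1]
    · by_cases h2 : i.val < m - t
      · simp [g, h1, h2]; omega
      · simp [g, h1, h2]
  have hfsum := Finset.card_eq_sum_card_fiberwise (f := f) (s := Finset.univ) (t := Finset.univ)
    (fun _ _ => by simp)
  have hgsum := Finset.card_eq_sum_card_fiberwise (f := g) (s := Finset.univ) (t := Finset.univ)
    (fun _ _ => by simp)
  rw [Fin.sum_univ_three, Finset.card_univ] at hfsum hgsum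
  rw [Fintype.card_fin] at hgsum
  have hf0 : (Finset.univ.filter fun v => f v = 0).card = t := by
    rw [ht]; congr 1; ext v; simp [(hf v).1]
  have hf1 : (Finset.univ.filter fun v => f v = 1).card = m - 2 * t := by
    rw [← hY]; congr 1; ext v; simp [(hf v).2]
  have hg0 : (Finset.univ.filter fun i => g i = 0).card = t := by
    rw [← card_filter_fin_lt (show t ≤ n by omega)]
    congr 1; ext v; simp [(hg v).1]
  have hg1 : (Finset.univ.filter fun i => g i = 1).card = m - 2 * t := by
    have h1 : (Finset.univ.filter fun i : Fin n => i.val < m - t) =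
        (Finset.univ.filter fun i => g i = 0) ∪ (Finset.univ.filter fun i => g i = 1) := by
      ext i
      simp only [Finset.mem_filter, Finset.mem_univ, true_and, Finset.mem_union, (hg i).1, (hg i).2]
      omega
    have h2 := congrArg Finset.card h1
    rw [Finset.card_union_of_disjoint, card_filter_fin_lt hn, hg0] at h2
    · omega
    · rw [Finset.disjoint_filter]
      intro i _ h h'
      rw [h] at h'
      exact absurd h' (by decide)
  have hcard : ∀ c, Fintype.card {v // f v = c} = Fintype.card {i // g i = c} := by
    intro c
    rw [Fintype.card_subtype, Fintype.card_subtype]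
    fin_cases c
    · exact hf0.trans hg0.symm
    · exact hf1.trans hg1.symm
    · change (Finset.univ.filter fun v => f v = 2).card = (Finset.univ.filter fun i => g i = 2).card
      omega
  let e : V ≃ Fin n := Equiv.ofFiberEquiv fun c => Fintype.equivOfCardEq (hcard c)
  have he : ∀ v, g (e v) = f v := fun v => Equiv.ofFiberEquiv_map _ v
  have heT : ∀ v, v ∈ T ↔ (e v).val < t := fun v => by
    rw [← (hf v).1, ← he, (hg _).1]
  have heY : ∀ v, v ∈ Y ↔ t ≤ (e v).val ∧ (e v).val < m - t := fun v => by
    rw [← (hf v).2, ← he, (hg _).2]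
  refine ⟨⟨e, ?_⟩⟩
  intro a b
  change (e a ≠ e b ∧ _) ↔ (a ≠ b ∧ _)
  rw [e.injective.ne_iff, heT, heT, heY, heY]
  refine and_congr_right fun _ => ?_
  omega

end JoinGraph

/-! ### From p-th powers to squares. -/

section DegreePowerSum

open scoped Classical

variable {V : Type*} [Fintype V] {G H : SimpleGraph V} {p : ℝ}

theorem degreePowerSum_eq_sum_degIn :
    degreePowerSum p G = ∑ v, (degIn G Finset.univ v : ℝ) ^ p := by
  unfold degreePowerSum
  refine Finset.sum_congr rfl fun v _ => ?_
  rw [degIn, ← SimpleGraph.card_neighborFinset_eq_degree, SimpleGraph.neighborFinset_eq_filter]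

theorem degreePowerSum_lt_of_lt (hp : 0 < p) (h : G < H) :
    degreePowerSum p G < degreePowerSum p H := by
  rw [degreePowerSum_eq_sum_degIn, degreePowerSum_eq_sum_degIn]
  have hsub : ∀ v, Finset.univ.filter (G.Adj v) ⊆ Finset.univ.filter (H.Adj v) :=
    fun v => Finset.monotone_filter_right _ fun w _ hw => h.le hw
  obtain ⟨a, b, hab, hab'⟩ : ∃ a b, H.Adj a b ∧ ¬ G.Adj a b := by
    by_contra hcon
    push Not at hcon
    exact h.not_ge fun a b hab => hcon a b hab
  refine Finset.sum_lt_sum (fun v _ => ?_) ⟨a, Finset.mem_univ a, ?_⟩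
  · exact Real.rpow_le_rpow (Nat.cast_nonneg _)
      (Nat.cast_le.2 (Finset.card_le_card (hsub v))) hp.le
  · refine Real.rpow_lt_rpow (Nat.cast_nonneg _) (Nat.cast_lt.2 (Finset.card_lt_card ?_)) hp
    refine Finset.ssubset_iff_subset_ne.2 ⟨hsub a, fun heq => hab' ?_⟩
    have : b ∈ Finset.univ.filter (H.Adj a) := by simpa using hab
    rw [← heq] at this
    simpa using this

theorem le_degreePowerSum_joinGraph (hp : 0 ≤ p) (T Y : Finset V) :
    T.card * ((Fintype.card V - 1 : ℕ) : ℝ) ^ p +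
        (Fintype.card V - T.card : ℕ) * (T.card : ℝ) ^ p ≤
      degreePowerSum p (joinGraph T Y) := by
  rw [degreePowerSum_eq_sum_degIn, ← Finset.sum_add_sum_compl T, ← Finset.card_compl]
  refine add_le_add ?_ ?_
  · rw [← nsmul_eq_mul]
    refine Finset.card_nsmul_le_sum _ _ _ fun v hv => ?_
    refine Real.rpow_le_rpow (Nat.cast_nonneg _) (Nat.cast_le.2 ?_) hp
    rw [← Finset.card_univ, ← Finset.card_erase_of_mem (Finset.mem_univ v)]
    refine Finset.card_le_card fun w hw => ?_
    simp only [Finset.mem_filter, Finset.mem_univ, true_and]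
    exact ⟨(Finset.ne_of_mem_erase hw).symm, Or.inl hv⟩
  · rw [← nsmul_eq_mul]
    refine Finset.card_nsmul_le_sum _ _ _ fun v hv => ?_
    refine Real.rpow_le_rpow (Nat.cast_nonneg _) (Nat.cast_le.2 ?_) hp
    refine Finset.card_le_card fun w hw => ?_
    simp only [Finset.mem_filter, Finset.mem_univ, true_and]
    exact ⟨fun h => Finset.mem_compl.1 hv (h ▸ hw), Or.inr (Or.inl hw)⟩

/-- Bernoulli's inequality for (y / x) ^ 2 with exponent p / 2 yields the factor p / 2 * x ^ (p -
2). Then p / 2 ≤ exp ((p - 2) / 2) ≤ (5 / 3) ^ (p - 2), and 5x/3 ≤ N absorbs it. -/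
theorem rpow_sub_rpow_le {x y N : ℝ} (hp : 2 ≤ p) (hy : 0 ≤ y) (hyx : y < x)
    (hx : 5 * x ≤ 3 * N) : x ^ p - y ^ p ≤ N ^ (p - 2) * (x ^ 2 - y ^ 2) := by
  have hx0 : 0 < x := hy.trans_lt hyx
  have hbern : 1 + p / 2 * ((y / x) ^ 2 - 1) ≤ (y / x) ^ p := by
    have h := one_add_mul_self_le_rpow_one_add (s := (y / x) ^ 2 - 1)
      (by nlinarith [sq_nonneg (y / x)]) (p := p / 2) (by linarith)
    have h2 : (1 + ((y / x) ^ 2 - 1)) ^ (p / 2) = (y / x) ^ p := by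
      rw [add_sub_cancel, ← Real.rpow_natCast, ← Real.rpow_mul (by positivity)]
      congr 1
      push_cast
      ring
    rwa [h2] at h
  have hyp : y ^ p = x ^ p * (y / x) ^ p := by
    rw [← Real.mul_rpow hx0.le (by positivity)]
    congr 1
    field_simp
  have hxp : x ^ p = x ^ (p - 2) * x ^ 2 := by
    rw [← Real.rpow_natCast x 2, ← Real.rpow_add hx0]
    congr 1
    push_cast
    ring
  have h1 : x ^ p - y ^ p ≤ p / 2 * x ^ (p - 2) * (x ^ 2 - y ^ 2) := by
    have h2 : x ^ p * (1 + p / 2 * ((y / x) ^ 2 - 1)) ≤ y ^ p := by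
      rw [hyp]
      exact mul_le_mul_of_nonneg_left hbern (by positivity)
    have h3 : x ^ p * (1 + p / 2 * ((y / x) ^ 2 - 1)) =
        x ^ p - p / 2 * x ^ (p - 2) * (x ^ 2 - y ^ 2) := by
      rw [hxp]
      field_simp
      ring
    linarith
  have h4 : p / 2 * x ^ (p - 2) ≤ N ^ (p - 2) := by
    have he : Real.exp (1 / 2) ≤ 5 / 3 := by
      have h5 : Real.exp (1 / 2) ^ 2 ≤ (5 / 3) ^ 2 := by
        rw [← Real.exp_nat_mul]
        have := Real.exp_one_lt_d9
        norm_num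
        linarith
      exact (sq_le_sq₀ (Real.exp_pos _).le (by norm_num)).1 h5
    have h6 : p / 2 ≤ (5 / 3 : ℝ) ^ (p - 2) := by
      calc p / 2 = 1 / 2 * (p - 2) + 1 := by ring
        _ ≤ Real.exp (1 / 2 * (p - 2)) := Real.add_one_le_exp _
        _ = Real.exp (1 / 2) ^ (p - 2) := by rw [Real.exp_mul]
        _ ≤ _ := Real.rpow_le_rpow (Real.exp_pos _).le he (by linarith)
    calc p / 2 * x ^ (p - 2) ≤ (5 / 3 : ℝ) ^ (p - 2) * x ^ (p - 2) :=
          mul_le_mul_of_nonneg_right h6 (by positivity)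
      _ = (5 / 3 * x) ^ (p - 2) := (Real.mul_rpow (by norm_num) hx0.le).symm
      _ ≤ N ^ (p - 2) := Real.rpow_le_rpow (by positivity) (by linarith) (by linarith)
  exact h1.trans (mul_le_mul_of_nonneg_right h4 (by nlinarith))

/-- A lower bound on the sum of `p`-th powers gives the corresponding inequality for squares. -/
theorem sum_sq_sub_sq_le {N : ℕ} (hp : 2 ≤ p) (hN : 0 < N) (T : Finset V) (d : V → ℕ)
    (hd : ∀ v, d v ≤ N) (hT : ∀ v ∉ T, 5 * d v ≤ 3 * N)
    (hsum : T.card * (N : ℝ) ^ p + (Fintype.card V - T.card : ℕ) * (T.card : ℝ) ^ p ≤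
      ∑ v, (d v : ℝ) ^ p) :
    ∑ v ∈ T, (N ^ 2 - d v ^ 2) ≤ ∑ v ∈ Tᶜ, (d v ^ 2 - T.card ^ 2) := by
  have hN' : (0 : ℝ) < N := Nat.cast_pos.2 hN
  have hpos : 0 < (N : ℝ) ^ (p - 2) := by positivity
  have hsplit : ∀ a : ℝ, 0 ≤ a → a ^ p = a ^ (p - 2) * a ^ 2 := by
    intro a ha
    rw [← Real.rpow_natCast a 2, ← Real.rpow_add_of_nonneg ha (by linarith) (by norm_num)]
    congr 1
    push_cast
    ring
  -- On T the comparison runs the other way and needs only d ≤ N.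
  have h1 : (N : ℝ) ^ (p - 2) * ((∑ v ∈ T, (N ^ 2 - d v ^ 2) : ℕ) : ℝ) ≤
      ∑ v ∈ T, ((N : ℝ) ^ p - (d v : ℝ) ^ p) := by
    rw [Nat.cast_sum, Finset.mul_sum]
    refine Finset.sum_le_sum fun v _ => ?_
    rw [Nat.cast_sub (Nat.pow_le_pow_left (hd v) 2), hsplit _ hN'.le,
      hsplit _ (Nat.cast_nonneg (d v))]
    push_cast
    have : (d v : ℝ) ^ (p - 2) ≤ (N : ℝ) ^ (p - 2) :=
      Real.rpow_le_rpow (Nat.cast_nonneg _) (Nat.cast_le.2 (hd v)) (by linarith)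
    nlinarith [sq_nonneg (d v : ℝ)]
  have h2 : ∑ v ∈ Tᶜ, ((d v : ℝ) ^ p - (T.card : ℝ) ^ p) ≤
      (N : ℝ) ^ (p - 2) * ((∑ v ∈ Tᶜ, (d v ^ 2 - T.card ^ 2) : ℕ) : ℝ) := by
    rw [Nat.cast_sum, Finset.mul_sum]
    refine Finset.sum_le_sum fun v hv => ?_
    rcases le_or_gt (d v) T.card with h | h
    · have : (d v : ℝ) ^ p ≤ (T.card : ℝ) ^ p :=
        Real.rpow_le_rpow (Nat.cast_nonneg _) (Nat.cast_le.2 h) (by linarith)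
      have : (0 : ℝ) ≤ (N : ℝ) ^ (p - 2) * ((d v ^ 2 - T.card ^ 2 : ℕ) : ℝ) := by positivity
      linarith
    · rw [Nat.cast_sub (Nat.pow_le_pow_left h.le 2)]
      push_cast
      exact rpow_sub_rpow_le hp (Nat.cast_nonneg _) (Nat.cast_lt.2 h)
        (by exact_mod_cast hT v (Finset.mem_compl.1 hv))
  rw [Finset.sum_sub_distrib, Finset.sum_const, nsmul_eq_mul] at h1 h2
  rw [Finset.card_compl] at h2
  rw [← Finset.sum_add_sum_compl T] at hsum
  have h3 := le_of_mul_le_mul_left (h1.trans (le_trans (by linarith) h2)) hpos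
  exact_mod_cast h3

end DegreePowerSum

/-! ### Paths ending next to a set of hubs. -/

section Attached

open scoped Classical

variable {V : Type*} {G : SimpleGraph V} {S : Finset V} {v w x : V} {k L : ℕ}

/-- The list `l` ends at a vertex with a neighbour in `S`. -/
def EndsNear (G : SimpleGraph V) (S : Finset V) (l : List V) : Prop :=
  ∃ c ∈ l.getLast?, ∃ x ∈ S, G.Adj c x

theorem EndsNear.append {l l' : List V} (h : EndsNear G S l) : EndsNear G S (l' ++ l) := by
  obtain ⟨c, hc, x, hx, hcx⟩ := h
  refine ⟨c, ?_, x, hx, hcx⟩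
  rw [Option.mem_def] at hc ⊢
  rw [List.getLast?_append, hc]
  rfl

theorem EndsNear.of_append {l l' : List V} (hl : l ≠ []) (h : EndsNear G S (l' ++ l)) :
    EndsNear G S l := by
  obtain ⟨c, hc, x, hx, hcx⟩ := h
  refine ⟨c, ?_, x, hx, hcx⟩
  rw [Option.mem_def] at hc ⊢
  rwa [List.getLast?_append, List.getLast?_eq_some_getLast hl, Option.some_or,
    ← List.getLast?_eq_some_getLast hl] at hc

theorem endsNear_singleton (hx : x ∈ S) (h : G.Adj v x) : EndsNear G S [v] :=
  ⟨v, rfl, x, hx, h⟩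

variable [Fintype V]

/-- The vertices outside `S` from which `S` can be reached. -/
noncomputable def attached (G : SimpleGraph V) (S : Finset V) : Finset V :=
  Finset.univ.filter fun v => ∃ l, PathIn G Sᶜ (v :: l) ∧ EndsNear G S (v :: l)

theorem mem_attached_iff :
    v ∈ attached G S ↔ ∃ l, PathIn G Sᶜ (v :: l) ∧ EndsNear G S (v :: l) := by
  simp [attached]

theorem notMem_of_mem_attached (h : v ∈ attached G S) : v ∉ S := by
  obtain ⟨l, hl, -⟩ := mem_attached_iff.1 h
  simpa using hl.mem v (by simp)

theorem attached_subset_compl : attached G S ⊆ Sᶜ := fun v hv => by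
  simpa using notMem_of_mem_attached hv

theorem mem_attached_of_adj (hv : v ∉ S) (hx : x ∈ S) (h : G.Adj v x) : v ∈ attached G S :=
  mem_attached_iff.2 ⟨[], PathIn.singleton (by simpa using hv), endsNear_singleton hx h⟩

/-- Hence `attached G S` is a union of components of G - S. -/
theorem mem_attached_of_adj_attached (hv : v ∈ attached G S) (hw : w ∉ S) (h : G.Adj v w) :
    w ∈ attached G S := by
  obtain ⟨l, hl, hend⟩ := mem_attached_iff.1 hv
  by_cases hwl : w ∈ v :: l
  · obtain ⟨X, Y, hXY⟩ := List.append_of_mem hwl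
    rw [hXY] at hl hend
    exact mem_attached_iff.2 ⟨Y, hl.infix (List.suffix_append _ _).isInfix,
      hend.of_append (by simp)⟩
  · exact mem_attached_iff.2 ⟨v :: l, hl.cons (by simpa using hw) hwl (by simpa using h.symm),
      hend.append (l' := [w])⟩

/-- If all paths ending next to `S` have at most `L` vertices then the attached vertices span no
path on `2 * L` vertices. -/
theorem length_ne_of_pathIn_attached
    (hL : ∀ l, PathIn G Sᶜ l → EndsNear G S l → l.length ≤ L) (hL0 : 0 < L) (l : List V)
    (hl : PathIn G (attached G S) l) : l.length ≠ 2 * L := by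
  intro hlen
  -- A shortest connection from l towards S meets l only in its start v. Each of the two parts of l
  -- at v extends along it, so each has fewer than L vertices besides v.
  have hex : ∃ m, ∃ v ∈ l, ∃ q, PathIn G Sᶜ (v :: q) ∧ EndsNear G S (v :: q) ∧ q.length = m := by
    obtain ⟨a, l', rfl⟩ := List.exists_cons_of_ne_nil (l := l) (by rintro rfl; simp at hlen; omega)
    obtain ⟨q, hq, hq'⟩ := mem_attached_iff.1 (hl.mem a (by simp))
    exact ⟨_, a, by simp, q, hq, hq', rfl⟩
  obtain ⟨v, hv, q, hq, hqe, hqlen⟩ := Nat.find_spec hex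
  have hdisj : ∀ y ∈ l, y ∉ q := by
    intro y hyl hyq
    obtain ⟨X, Y, rfl⟩ := List.append_of_mem hyq
    refine Nat.find_min hex (m := Y.length) ?_ ⟨y, hyl, Y, ?_, ?_, rfl⟩
    · rw [← hqlen]; simp only [List.length_append, List.length_cons]; omega
    · exact hq.infix (List.suffix_append (v :: X) _).isInfix
    · exact hqe.of_append (l' := v :: X) (by simp)
  have key : ∀ A B, PathIn G (attached G S) (A ++ v :: B) → (∀ y ∈ A, y ∉ q) → A.length < L := by
    intro A B h hA
    have hd := List.nodup_append.1 h.nodup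
    have hc := (List.isChain_append.1 h.chain).2.2
    have hp : PathIn G Sᶜ (A ++ v :: q) := by
      refine ((h.infix (List.prefix_append _ _).isInfix).mono attached_subset_compl).append hq
        (fun x hx y hy => hc x hx y (by simpa using hy)) ?_
      intro y hy hy'
      rcases List.mem_cons.1 hy' with rfl | hy'
      · exact hd.2.2 y hy y (by simp) rfl
      · exact hA y hy hy'
    have := hL _ hp hqe.append
    simp only [List.length_append, List.length_cons] at this
    omega
  obtain ⟨A, B, rfl⟩ := List.append_of_mem hv
  have h1 := key A B hl fun y hy => hdisj y (by simp [hy])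
  have h2 := key B.reverse A.reverse (by simpa using hl.reverse)
    fun y hy => hdisj y (by simp at hy; simp [hy])
  simp only [List.length_append, List.length_cons, List.length_reverse] at h1 h2 hlen
  omega

/-- Paths ending next to a set of pairwise well linked vertices are short. -/
theorem length_add_lt_of_endsNear
    (hcod : ∀ x ∈ S, ∀ y ∈ S, k ≤ (Finset.univ.filter fun z => G.Adj x z ∧ G.Adj y z).card)
    (hno : ∀ l, PathIn G Finset.univ l → l.length ≠ k) (hS : 2 * S.card ≤ k) (l : List V)
    (hl : PathIn G Sᶜ l) (hend : EndsNear G S l) : l.length + 2 * S.card < k := by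
  by_contra hcon
  push Not at hcon
  have hend' := hend
  obtain ⟨c, hc, x, hx, hcx⟩ := hend
  -- Only the last k - 2|S| vertices are kept; continuing through S adds 2|S| more and produces
  -- exactly k.
  have hsplit : l.take (l.length - (k - 2 * S.card)) ++ l.drop (l.length - (k - 2 * S.card)) = l :=
    List.take_append_drop _ _
  set Q := l.drop (l.length - (k - 2 * S.card)) with hQ
  have hQlen : Q.length = k - 2 * S.card := by rw [hQ, List.length_drop]; omega
  have hQp : PathIn G Sᶜ Q := hl.infix (List.drop_suffix _ _).isInfix
  have hlen : (x :: (S.erase x).toList).length = S.card := by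
    simp only [List.length_cons, Finset.length_toList]
    exact Finset.card_erase_add_one hx
  have hmem : ∀ y ∈ x :: (S.erase x).toList, y ∈ S := by
    intro y hy
    rcases List.mem_cons.1 hy with rfl | hy
    · exact hx
    · exact Finset.mem_of_mem_erase (Finset.mem_toList.1 hy)
  obtain ⟨l', h1, h2⟩ := exists_path_tail (k := k) (l := x :: (S.erase x).toList) (Q := Q)
    (List.nodup_cons.2 ⟨by simp, Finset.nodup_toList _⟩)
    (fun a ha b hb => hcod a (hmem a ha) b (hmem b hb)) (by simp)
    (hQp.mono (Finset.subset_univ _))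
    (fun y hy hyQ => by simpa [hmem y hy] using hQp.mem y hyQ) (by
      intro a ha y hy
      simp only [List.head?_cons, Option.mem_def, Option.some.injEq] at hy
      have hQne : Q ≠ [] := by intro h; rw [h] at ha; simp at ha
      rw [← hsplit, List.getLast?_append, List.getLast?_eq_some_getLast hQne, Option.some_or,
        ← List.getLast?_eq_some_getLast hQne] at hc
      rw [Option.mem_def] at ha hc
      rw [ha, Option.some.injEq] at hc
      subst hc hy
      exact hcx) (by omega)
  exact hno l' h1 (by omega)

/-- With t + 1 hubs, a single outside neighbour already gives a path on 1 + 2(t + 1) ≥ k vertices.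
-/
theorem card_le_of_codegree {t : ℕ}
    (hcod : ∀ x ∈ S, ∀ y ∈ S, k ≤ (Finset.univ.filter fun z => G.Adj x z ∧ G.Adj y z).card)
    (hno : ∀ l, PathIn G Finset.univ l → l.length ≠ k) (hk₁ : 2 * t + 2 ≤ k)
    (hk₂ : k ≤ 2 * t + 3) : S.card ≤ t := by
  by_contra hcon
  obtain ⟨S', hS', hcard⟩ := Finset.exists_subset_card_eq (show t + 1 ≤ S.card by omega)
  obtain ⟨x, hx⟩ : S'.Nonempty := Finset.card_pos.1 (by omega)
  obtain ⟨z, hz, hz'⟩ : ∃ z ∈ Finset.univ.filter (fun z => G.Adj x z ∧ G.Adj x z), z ∉ S' :=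
    Finset.exists_mem_notMem_of_card_lt_card
      (lt_of_lt_of_le (by omega) (hcod x (hS' hx) x (hS' hx)))
  simp only [Finset.mem_filter, Finset.mem_univ, true_and, and_self] at hz
  have := length_add_lt_of_endsNear (S := S')
    (fun a ha b hb => hcod a (hS' ha) b (hS' hb)) hno (by omega) [z]
    (PathIn.singleton (by simpa using hz')) (endsNear_singleton hx hz.symm)
  simp only [List.length_singleton] at this
  omega

end Attached

/-! ### Numerical consequences, with c = k - 2, N = n - 1 and A = c ^ 2 - t ^ 2. -/

section Arithmetic

variable {t c N q h u s r z g A E : ℕ}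

/-- The size h of the core is itself bounded through q; since A ≤ 3ct, the resulting term in q is
absorbed by N ≥ 10c. -/
theorem six_mul_le (ht : 1 ≤ t) (hc : 2 * t ≤ c) (hc' : c ≤ 2 * t + 1) (hN : 10 * c + 19 ≤ N)
    (hA : A + t ^ 2 = c ^ 2) (hE : E ≤ h * A) (hq : N * q ≤ c * q + E)
    (hh : t * h ≤ q + t * (c + 1)) : 6 * q ≤ A := by
  have hA3 : A ≤ 3 * c * t := by nlinarith
  have h1 : t * (N * q) ≤ t * (c * q) + (q + t * (c + 1)) * A := by
    calc t * (N * q) ≤ t * (c * q + h * A) := Nat.mul_le_mul_left _ (hq.trans (by omega))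
      _ = t * (c * q) + t * h * A := by ring
      _ ≤ _ := by gcongr
  have h2 : q * A ≤ q * (3 * c * t) := Nat.mul_le_mul_left _ hA3
  have h3 : t * ((10 * c + 19) * q) ≤ t * (N * q) := by gcongr
  have h4 : t * ((c + 1) * (6 * q)) ≤ t * ((c + 1) * A) := by nlinarith
  exact Nat.le_of_mul_le_mul_left (Nat.le_of_mul_le_mul_left h4 (by omega)) (by omega)

theorem sixteen_mul_le (ht : 1 ≤ t) (hc : 2 * t ≤ c) (hc' : c ≤ 2 * t + 1) (hN : 10 * c + 19 ≤ N)
    (hA : A + t ^ 2 = c ^ 2) (hq : 6 * q ≤ A) (hr : r * (9 * N) ≤ 20 * q + 10 * r) :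
    16 * r ≤ t := by
  by_contra hcon
  have h1 : A ≤ (3 * t + 1) * (t + 1) := by nlinarith
  have h2 : r * (9 * (20 * t + 19)) ≤ r * (9 * N) := by gcongr; omega
  have h3 : (t + 1) * (180 * t + 161) ≤ 16 * r * (180 * t + 161) := by gcongr; omega
  nlinarith

/-- Here r counts the non-hubs in T and u the vertices not attached to the s hubs. The gain u * A is
absorbed by the deficiency s * u, because A ≤ (N - c) * s. What remains is proportional to r on both
sides; after cancelling r, a product of two terms of order N is too large for a multiple of (c + t)
* h. -/
theorem false_of_pos (ht : 1 ≤ t) (hc : 2 * t ≤ c) (hc' : c ≤ 2 * t + 1) (hN : 10 * c + 19 ≤ N)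
    (hA : A + t ^ 2 = c ^ 2) (hq6 : 6 * q ≤ A) (hr : 16 * r ≤ t) (hs : s + r = t) (hr0 : 1 ≤ r)
    (hq : 20 * (s * u) + r * (9 * N) ≤ 20 * q + 10 * r) (hh : t * h ≤ q + t * (c + 1))
    (hE : N * q ≤ c * q + (u * A + (c + t) * (6 * r * h))) : False := by
  have h1 : A ≤ (3 * t + 1) * (t + 1) := by nlinarith
  have h2 : 3 * h ≤ 3 * c + 3 + 4 * t := by
    have : t * (3 * h) ≤ t * (3 * c + 3 + 4 * t) := by nlinarith
    exact Nat.le_of_mul_le_mul_left this (by omega)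
  obtain ⟨M, rfl⟩ : ∃ M, N = c + M := ⟨N - c, by omega⟩
  have hM : 18 * t + 19 ≤ M := by omega
  have h3 : M * q ≤ u * A + (c + t) * (6 * r * h) := by nlinarith
  have h4 : A ≤ M * s := by
    have h5 : (18 * t + 19) * s ≤ M * s := by gcongr
    nlinarith
  have h5 : u * A ≤ u * (M * s) := by gcongr
  have h6 : 20 * (M * (s * u)) + M * (r * (9 * (c + M) - 10)) ≤ 20 * (M * q) := by
    have : 20 * (s * u) + r * (9 * (c + M) - 10) ≤ 20 * q := by
      have : r * 10 ≤ r * (9 * (c + M)) := Nat.mul_le_mul_left _ (by omega)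
      rw [Nat.mul_sub]; omega
    nlinarith
  have h7 : M * (r * (9 * (c + M) - 10)) ≤ 20 * ((c + t) * (6 * r * h)) := by nlinarith
  have h8 : r * (M * (9 * (c + M) - 10)) ≤ r * (120 * ((c + t) * h)) := by
    calc _ = M * (r * (9 * (c + M) - 10)) := by ring
      _ ≤ _ := h7
      _ = _ := by ring
  have h9 := Nat.le_of_mul_le_mul_left h8 hr0
  have h10 : (18 * t + 19) * (180 * t + 161) ≤ M * (9 * (c + M) - 10) :=
    Nat.mul_le_mul hM (by omega)
  have h11 : (c + t) * (3 * h) ≤ (3 * t + 1) * (10 * t + 6) := Nat.mul_le_mul (by omega) (by omega)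
  nlinarith

/-- Each of the z far vertices costs at least (N - c) * t, about 18 * t ^ 2, and gains at most A,
about 3 * t ^ 2; the error g is too small to compensate for even one. -/
theorem eq_zero_of_mul_le (ht : 1 ≤ t) (hc : 2 * t ≤ c) (hc' : c ≤ 2 * t + 1)
    (hN : 10 * c + 19 ≤ N) (hA : A + t ^ 2 = c ^ 2) (hq : t * z ≤ q) (hg : g ≤ 2 * (2 * t + 1))
    (hE : N * q ≤ c * q + (z * A + g)) : z = 0 := by
  by_contra hz
  have h1 : A ≤ (3 * t + 1) * (t + 1) := by nlinarith
  obtain ⟨M, rfl⟩ : ∃ M, N = c + M := ⟨N - c, by omega⟩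
  have hM : 18 * t + 19 ≤ M := by omega
  have h3 : M * q ≤ z * A + g := by nlinarith
  have h4 : (18 * t + 19) * (t * z) ≤ M * q := Nat.mul_le_mul hM hq
  have h5 : z * A ≤ z * ((3 * t + 1) * (t + 1)) := by gcongr
  have h6 : 1 * (15 * t ^ 2 + 15 * t) ≤ z * (15 * t ^ 2 + 15 * t) := by gcongr; omega
  nlinarith [Nat.pos_of_ne_zero hz]

end Arithmetic

/-! ### The main inequality for the deficiency of the top degrees. -/

section Extremal

open scoped Classical

variable {V : Type*} [Fintype V] {G : SimpleGraph V} {k t : ℕ}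

theorem exists_card_eq_forall_le {d : V → ℕ} (ht : 1 ≤ t) (htV : t ≤ Fintype.card V) :
    ∃ T : Finset V, T.card = t ∧ ∃ m, (∀ x ∈ T, m ≤ d x) ∧ ∀ v ∉ T, d v ≤ m := by
  have key : ∀ s ≤ Fintype.card V,
      ∃ T : Finset V, T.card = s ∧ ∀ x ∈ T, ∀ v ∉ T, d v ≤ d x := by
    intro s
    induction s with
    | zero => exact fun _ => ⟨∅, rfl, by simp⟩
    | succ s ih =>
      intro hs
      obtain ⟨T, hT, hTd⟩ := ih (by omega)
      obtain ⟨y, hy, hmax⟩ := Tᶜ.exists_max_image d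
        (Finset.card_pos.1 (by rw [Finset.card_compl]; omega))
      rw [Finset.mem_compl] at hy
      refine ⟨insert y T, by rw [Finset.card_insert_of_notMem hy, hT], fun x hx v hv => ?_⟩
      rw [Finset.mem_insert, not_or] at hv
      rcases Finset.mem_insert.1 hx with rfl | hx
      · exact hmax v (Finset.mem_compl.2 hv.2)
      · exact hTd x hx v hv.2
  obtain ⟨T, hT, hTd⟩ := key t htV
  obtain ⟨x, hx, hmin⟩ := T.exists_min_image d (Finset.card_pos.1 (by omega))
  exact ⟨T, hT, d x, hmin, fun v hv => hTd x hx v hv⟩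

/-- If the squares of the `t` largest degrees are nearly as large as possible compared with the
remaining ones, then the deficiency `∑ x ∈ T, (n - 1 - d x)` of these degrees is controlled by the
inner degrees of a set `H` that is left after deleting vertices of degree at most `t`. -/
theorem exists_core {T : Finset V} {m : ℕ} (hk : k ≤ 2 * (t + 1) + 1) (htk : t + 2 ≤ k)
    (hkV : k ≤ Fintype.card V) (hno : ∀ l, PathIn G Finset.univ l → l.length ≠ k)
    (hT : T.card = t) (hmT : ∀ x ∈ T, m ≤ degIn G Finset.univ x)
    (hm : ∀ v ∉ T, degIn G Finset.univ v ≤ m)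
    (hsq : ∑ v ∈ T, ((Fintype.card V - 1) ^ 2 - degIn G Finset.univ v ^ 2) ≤
      ∑ v ∈ Tᶜ, (degIn G Finset.univ v ^ 2 - t ^ 2)) :
    ∃ H : Finset V, (∀ v ∈ H, degIn G H v + 2 ≤ k) ∧
      t * H.card ≤ ∑ x ∈ T, (Fintype.card V - 1 - degIn G Finset.univ x) + t * (k - 2 + 1) ∧
      (Fintype.card V - 1) * ∑ x ∈ T, (Fintype.card V - 1 - degIn G Finset.univ x) ≤
        (k - 2) * ∑ x ∈ T, (Fintype.card V - 1 - degIn G Finset.univ x) +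
          ∑ v ∈ H \ T, (degIn G H v ^ 2 - t ^ 2) := by
  set d := degIn G Finset.univ with hd
  set N := Fintype.card V - 1 with hN
  set q := ∑ x ∈ T, (N - d x) with hq
  have hdN : ∀ v, d v ≤ N := by
    intro v
    have : d v + 1 ≤ _ := degIn_add_one_le_card (Finset.mem_univ v)
    rw [Finset.card_univ] at this
    omega
  obtain ⟨H, -, f, b, h1, h2, h3, h4, h5, h6⟩ := exists_peeling hk htk hno
    (by rw [Finset.card_univ]; omega)
  rw [Finset.card_univ] at h6
  rw [← hd] at h1
  have hbk : ∀ v, b v ≤ k - 2 := by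
    intro v
    by_cases hv : v ∈ H
    · have := h3 v hv; omega
    · have := h4 v (Finset.mem_univ v) hv; omega
  -- For deleted vertices this relies on |H| ≥ t + 1.
  have hbH : ∀ v, b v + 1 ≤ H.card := by
    intro v
    by_cases hv : v ∈ H
    · rw [h2 v hv]; exact degIn_add_one_le_card hv
    · have := h4 v (Finset.mem_univ v) hv; omega
  have hfb : ∑ x ∈ T, f x + ∑ x ∈ T, b x + q = t * N := by
    rw [hq, ← Finset.sum_add_distrib, ← Finset.sum_add_distrib, ← hT, ← smul_eq_mul,
      ← Finset.sum_const]
    refine Finset.sum_congr rfl fun x _ => ?_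
    have := h1 x (Finset.mem_univ x)
    have := hdN x
    omega
  have hsplit := Finset.sum_add_sum_compl T f
  have hF : ∑ x ∈ Tᶜ, f x + t * H.card ≤ q + ∑ x ∈ T, b x + t := by
    have : t * Fintype.card V = t * N + t := by
      rw [show Fintype.card V = N + 1 by omega]; ring
    omega
  have hb1 : ∑ x ∈ T, b x ≤ t * (k - 2) := by
    rw [← hT, ← smul_eq_mul, ← Finset.sum_const]
    exact Finset.sum_le_sum fun x _ => hbk x
  have hb2 : ∑ x ∈ T, b x + t ≤ t * H.card := by
    rw [← smul_eq_mul, ← hT, ← Finset.sum_const, Finset.card_eq_sum_ones,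
      ← Finset.sum_add_distrib]
    exact Finset.sum_le_sum fun x _ => hbH x
  -- The sum of f is at most t * (n - |H|), and the vertices of T already use all of t * N except q
  -- and their b-part.
  have hFq : ∑ x ∈ Tᶜ, f x ≤ q := by omega
  refine ⟨H, fun v hv => h2 v hv ▸ h3 v hv, by rw [mul_add, mul_one]; omega, ?_⟩
  have hleft : (N + m) * q ≤ ∑ v ∈ T, (N ^ 2 - d v ^ 2) := by
    rw [hq, Finset.mul_sum]
    refine Finset.sum_le_sum fun x hx => ?_
    rw [Nat.sq_sub_sq]
    exact Nat.mul_le_mul_right _ (by have := hmT x hx; omega)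
  have hright : ∑ v ∈ Tᶜ, (d v ^ 2 - t ^ 2) ≤
      (m + (k - 2)) * ∑ v ∈ Tᶜ, f v + ∑ v ∈ H \ T, (degIn G H v ^ 2 - t ^ 2) := by
    have hE : ∑ v ∈ H \ T, (degIn G H v ^ 2 - t ^ 2) = ∑ v ∈ Tᶜ, (b v ^ 2 - t ^ 2) := by
      rw [← Finset.sum_subset (s₁ := H \ T) (s₂ := Tᶜ) (fun v hv => by
        simpa using (Finset.mem_sdiff.1 hv).2)]
      · exact Finset.sum_congr rfl fun v hv => by rw [h2 v (Finset.mem_sdiff.1 hv).1]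
      · intro v hv hvH
        have : v ∉ H := fun h => hvH (Finset.mem_sdiff.2 ⟨h, Finset.mem_compl.1 hv⟩)
        exact Nat.sub_eq_zero_of_le (Nat.pow_le_pow_left (h4 v (Finset.mem_univ v) this) 2)
    rw [hE, Finset.mul_sum, ← Finset.sum_add_distrib]
    refine Finset.sum_le_sum fun v hv => ?_
    have hv1 := h1 v (Finset.mem_univ v)
    have hv2 := hm v (Finset.mem_compl.1 hv)
    have hv3 := hbk v
    rw [tsub_le_iff_right]
    have hv4 : b v ^ 2 ≤ b v ^ 2 - t ^ 2 + t ^ 2 := by omega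
    by_cases hvH : v ∈ H
    · have : d v ^ 2 ≤ (m + (k - 2)) * f v + b v ^ 2 := by
        calc d v ^ 2 = d v * f v + f v * b v + b v ^ 2 := by rw [hv1]; ring
          _ ≤ m * f v + f v * (k - 2) + b v ^ 2 := by gcongr
          _ = _ := by ring
      omega
    · have hv5 := h4 v (Finset.mem_univ v) hvH
      rcases le_or_gt (d v) t with hv6 | hv6
      · have := Nat.pow_le_pow_left hv6 2
        omega
      -- For deleted v with b v ≤ t, d ^ 2 - t ^ 2 = (d + t) * (d - t), where d - t ≤ f v.
      · have : d v ^ 2 ≤ (m + (k - 2)) * f v + t ^ 2 := by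
          rw [← tsub_le_iff_right, Nat.sq_sub_sq]
          exact Nat.mul_le_mul (by omega) (by omega)
        omega
  have := Nat.mul_le_mul_left (m + (k - 2)) hFq
  -- The threshold m separating T from the rest occurs on both sides and cancels.
  have hfin : (N + m) * q ≤ (m + (k - 2)) * q + ∑ v ∈ H \ T, (degIn G H v ^ 2 - t ^ 2) := by
    omega
  rw [add_mul, add_mul] at hfin
  omega

end Extremal

/-! ### All t top vertices are hubs. -/

section Hubs

open scoped Classical

variable {V : Type*} [Fintype V] {G : SimpleGraph V} {k t : ℕ}

theorem le_card_common_neighbors {x y : V} (hn : 10 * k ≤ Fintype.card V)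
    (hx : 11 * Fintype.card V ≤ 20 * degIn G Finset.univ x)
    (hy : 11 * Fintype.card V ≤ 20 * degIn G Finset.univ y) :
    k ≤ (Finset.univ.filter fun z => G.Adj x z ∧ G.Adj y z).card := by
  rw [Finset.filter_and]
  have h1 := Finset.card_union_add_card_inter (Finset.univ.filter (G.Adj x))
    (Finset.univ.filter (G.Adj y))
  have h2 := Finset.card_le_univ (Finset.univ.filter (G.Adj x) ∪ Finset.univ.filter (G.Adj y))
  unfold degIn at hx hy
  omega

theorem card_mul_card_le_sum {S Z : Finset V} (hSZ : Disjoint S Z)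
    (hadj : ∀ x ∈ S, ∀ z ∈ Z, ¬ G.Adj x z) :
    S.card * Z.card ≤ ∑ x ∈ S, (Fintype.card V - 1 - degIn G Finset.univ x) := by
  rw [← smul_eq_mul, ← Finset.sum_const]
  refine Finset.sum_le_sum fun x hx => ?_
  have h1 : Finset.univ.filter (G.Adj x) ⊆ (insert x Z)ᶜ := by
    intro y hy
    rw [Finset.mem_compl, Finset.mem_insert, not_or]
    have hy' : G.Adj x y := by simpa using hy
    exact ⟨hy'.ne', fun hyZ => hadj x hx y hyZ hy'⟩
  have h2 := Finset.card_le_card h1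
  have h3 := Finset.card_le_univ (insert x Z)
  rw [Finset.card_compl] at h2
  rw [Finset.card_insert_of_notMem (Finset.disjoint_left.1 hSZ hx)] at h2 h3
  unfold degIn
  omega

theorem sq_sub_sq_le_mul {b c d t : ℕ} (hbc : b ≤ c) (hb : b ≤ t + d) :
    b ^ 2 - t ^ 2 ≤ (c + t) * d := by
  rw [Nat.sq_sub_sq]
  exact Nat.mul_le_mul (by omega) (by omega)

/-- Under the inequality for squares there are `t` vertices which pairwise have many common
neighbours. -/
theorem exists_hubs (ht : 1 ≤ t) (hk₁ : 2 * t + 2 ≤ k) (hk₂ : k ≤ 2 * t + 3)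
    (hn : 10 * k ≤ Fintype.card V) (hno : ∀ l, PathIn G Finset.univ l → l.length ≠ k)
    (hsq : ∀ T : Finset V, T.card = t →
      (∀ v ∉ T, 5 * degIn G Finset.univ v ≤ 3 * (Fintype.card V - 1)) →
      ∑ v ∈ T, ((Fintype.card V - 1) ^ 2 - degIn G Finset.univ v ^ 2) ≤
        ∑ v ∈ Tᶜ, (degIn G Finset.univ v ^ 2 - t ^ 2)) :
    ∃ T : Finset V, T.card = t ∧
      (∀ x ∈ T, ∀ y ∈ T, k ≤ (Finset.univ.filter fun z => G.Adj x z ∧ G.Adj y z).card) ∧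
      ∃ H : Finset V, (∀ v ∈ H, degIn G H v + 2 ≤ k) ∧
        (Fintype.card V - 1) * ∑ x ∈ T, (Fintype.card V - 1 - degIn G Finset.univ x) ≤
          (k - 2) * ∑ x ∈ T, (Fintype.card V - 1 - degIn G Finset.univ x) +
            ∑ v ∈ H \ T, (degIn G H v ^ 2 - t ^ 2) := by
  obtain ⟨T, hT, m, hmT, hm⟩ := exists_card_eq_forall_le (V := V) (d := degIn G Finset.univ) ht
    (by omega)
  -- The threshold 11/20 makes two neighbourhoods share n/10 ≥ k vertices, while the other degrees
  -- stay below 3/5 of n - 1.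
  set S := Finset.univ.filter fun v => 11 * Fintype.card V ≤ 20 * degIn G Finset.univ v with hS
  have hmemS : ∀ v, v ∈ S ↔ 11 * Fintype.card V ≤ 20 * degIn G Finset.univ v := by simp [hS]
  have hcod : ∀ x ∈ S, ∀ y ∈ S,
      k ≤ (Finset.univ.filter fun z => G.Adj x z ∧ G.Adj y z).card := fun x hx y hy =>
    le_card_common_neighbors hn ((hmemS x).1 hx) ((hmemS y).1 hy)
  have hSt : S.card ≤ t := card_le_of_codegree hcod hno hk₁ hk₂
  have hST : S ⊆ T := by
    intro v hv
    by_contra hvT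
    have hsub : insert v T ⊆ S := by
      refine Finset.insert_subset hv fun x hx => (hmemS x).2 ?_
      have := (hmemS v).1 hv
      have := hm v hvT
      have := hmT x hx
      omega
    have := Finset.card_le_card hsub
    rw [Finset.card_insert_of_notMem hvT] at this
    omega
  obtain ⟨H, hH, hHq, hHE⟩ := exists_core (T := T) (m := m) (by omega) (by omega) (by omega) hno hT
    hmT hm (hsq T hT fun v hv => by
      have : ¬ _ := fun h => hv (hST ((hmemS v).2 h))
      omega)
  have hA : (k - 2) ^ 2 - t ^ 2 + t ^ 2 = (k - 2) ^ 2 :=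
    Nat.sub_add_cancel (Nat.pow_le_pow_left (by omega) 2)
  have hgain : ∀ v ∈ H, degIn G H v ^ 2 - t ^ 2 ≤ (k - 2) ^ 2 - t ^ 2 := fun v hv =>
    Nat.sub_le_sub_right (Nat.pow_le_pow_left (by have := hH v hv; omega) 2) _
  have hE : ∑ v ∈ H \ T, (degIn G H v ^ 2 - t ^ 2) ≤ H.card * ((k - 2) ^ 2 - t ^ 2) := by
    refine (Finset.sum_le_sum_of_subset Finset.sdiff_subset).trans ?_
    rw [← smul_eq_mul]
    exact Finset.sum_le_card_nsmul _ _ _ hgain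
  have hq6 := six_mul_le ht (c := k - 2) (by omega) (by omega)
    (N := Fintype.card V - 1) (by omega) hA hE hHE hHq
  have hsplit := Finset.sum_sdiff (f := fun x => Fintype.card V - 1 - degIn G Finset.univ x) hST
  -- Integrality of 20 * d < 11 * (N + 1) turns the loss 11 into 10.
  have hTS : (T \ S).card * (9 * (Fintype.card V - 1)) ≤
      20 * ∑ x ∈ T \ S, (Fintype.card V - 1 - degIn G Finset.univ x) + 10 * (T \ S).card := by
    rw [Finset.mul_sum, mul_comm 10, ← smul_eq_mul, ← smul_eq_mul (a := (T \ S).card),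
      ← Finset.sum_const, ← Finset.sum_const, ← Finset.sum_add_distrib]
    refine Finset.sum_le_sum fun x hx => ?_
    have : ¬ _ := fun h => (Finset.mem_sdiff.1 hx).2 ((hmemS x).2 h)
    omega
  have hcard : S.card + (T \ S).card = t := by
    rw [Finset.card_sdiff_of_subset hST]; omega
  have hr16 := sixteen_mul_le (r := (T \ S).card) ht (c := k - 2) (by omega) (by omega)
    (N := Fintype.card V - 1) (by omega) hA hq6 (by omega)
  rcases Nat.eq_zero_or_pos (T \ S).card with hr | hr
  · have hTS' : S = T := Finset.eq_of_subset_of_card_le hST (by omega)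
    exact ⟨T, hT, hTS' ▸ hcod, H, hH, hHE⟩
  exfalso
  set Z := (S ∪ attached G S)ᶜ with hZ
  have hSZ : S.card * Z.card ≤ ∑ x ∈ S, (Fintype.card V - 1 - degIn G Finset.univ x) := by
    refine card_mul_card_le_sum ?_ ?_
    · rw [hZ, Finset.disjoint_left]
      intro x hx
      simp [hx]
    · intro x hx z hz hxz
      simp only [hZ, Finset.mem_compl, Finset.mem_union, not_or] at hz
      exact hz.2 (mem_attached_of_adj hz.1 hx hxz.symm)
  have hL := length_add_lt_of_endsNear hcod hno (by omega)
  have hEG := sum_degIn_le (G := G) (U := H ∩ attached G S) (k := 2 * (k - 1 - 2 * S.card))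
    fun l hl => length_ne_of_pathIn_attached (S := S)
      (fun l h1 h2 => by have := hL l h1 h2; omega) (by omega) l
      (hl.mono Finset.inter_subset_right)
  refine false_of_pos (r := (T \ S).card) (u := Z.card) (h := H.card) ht (c := k - 2) (by omega)
    (by omega) (N := Fintype.card V - 1) (by omega) hA hq6 hr16 hcard hr (by omega) hHq ?_
  refine hHE.trans (Nat.add_le_add_left ?_ _)
  -- Unattached vertices get the trivial bound; attached ones have at most |S| ≤ t neighbours in S,
  -- so their excess is controlled by degrees inside `attached G S`, where Erdős–Gallai applies.
  rw [← Finset.sum_filter_add_sum_filter_not (H \ T) (· ∈ attached G S), add_comm]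
  refine Nat.add_le_add ?_ ?_
  · refine (Finset.sum_le_card_nsmul _ _ ((k - 2) ^ 2 - t ^ 2) fun v hv => hgain v ?_).trans ?_
    · exact (Finset.mem_sdiff.1 (Finset.mem_filter.1 hv).1).1
    · rw [smul_eq_mul]
      refine Nat.mul_le_mul_right _ (Finset.card_le_card fun v hv => ?_)
      simp only [Finset.mem_filter, Finset.mem_sdiff] at hv
      simp only [hZ, Finset.mem_compl, Finset.mem_union, not_or]
      exact ⟨fun h => hv.1.2 (hST h), hv.2⟩
  · have hsub : (H \ T).filter (· ∈ attached G S) ⊆ H ∩ attached G S := by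
      intro v hv
      simp only [Finset.mem_filter, Finset.mem_sdiff] at hv
      exact Finset.mem_inter.2 ⟨hv.1.1, hv.2⟩
    calc _ ≤ ∑ v ∈ H ∩ attached G S, (degIn G H v ^ 2 - t ^ 2) :=
          Finset.sum_le_sum_of_subset hsub
      _ ≤ ∑ v ∈ H ∩ attached G S, (k - 2 + t) * degIn G (H ∩ attached G S) v := by
          refine Finset.sum_le_sum fun v hv => ?_
          obtain ⟨hvH, hva⟩ := Finset.mem_inter.1 hv
          refine sq_sub_sq_le_mul (by have := hH v hvH; omega) ?_
          have hsub' : H.filter (G.Adj v) ⊆ S ∪ (H ∩ attached G S).filter (G.Adj v) := by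
            intro w hw
            obtain ⟨hwH, hvw⟩ := Finset.mem_filter.1 hw
            by_cases hwS : w ∈ S
            · exact Finset.mem_union_left _ hwS
            · exact Finset.mem_union_right _ (Finset.mem_filter.2 ⟨Finset.mem_inter.2
                ⟨hwH, mem_attached_of_adj_attached hva hwS hvw⟩, hvw⟩)
          have h1 := Finset.card_le_card hsub'
          have h2 := Finset.card_union_le S ((H ∩ attached G S).filter (G.Adj v))
          unfold degIn
          omega
      _ = (k - 2 + t) * ∑ v ∈ H ∩ attached G S, degIn G (H ∩ attached G S) v := by
          rw [Finset.mul_sum]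
      _ ≤ _ := by
          -- With r = |T \ S| ≥ 1, 2 * (k - 1 - 2|S|) - 2 ≤ 4r + 2 ≤ 6r.
          refine Nat.mul_le_mul_left _ (hEG.trans (Nat.mul_le_mul (by omega) ?_))
          exact Finset.card_le_card Finset.inter_subset_left

end Hubs

/-! ### Edges outside the hubs. -/

section Structure

open scoped Classical

variable {V : Type*} {G : SimpleGraph V} {T H : Finset V} {k t : ℕ}

theorem degIn_le_degIn_add_card {F : Finset V} {u : V} (hF : ∀ y ∉ T, G.Adj u y → y ∈ F) :
    degIn G H u ≤ degIn G T u + F.card := by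
  refine (Finset.card_le_card (t := T.filter (G.Adj u) ∪ F) fun y hy => ?_).trans
    (Finset.card_union_le _ _)
  have hy' := (Finset.mem_filter.1 hy).2
  by_cases hyT : y ∈ T
  · exact Finset.mem_union_left _ (Finset.mem_filter.2 ⟨hyT, hy'⟩)
  · exact Finset.mem_union_right _ (hF y hyT hy')

theorem degIn_le_card {u : V} : degIn G T u ≤ T.card :=
  Finset.card_le_card (Finset.filter_subset _ _)

theorem adj_of_degIn_eq_card {u x : V} (h : T.card ≤ degIn G T u) (hx : x ∈ T) : G.Adj u x := by
  have := Finset.eq_of_subset_of_card_le (Finset.filter_subset (G.Adj u) T) h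
  rw [← this] at hx
  exact (Finset.mem_filter.1 hx).2

theorem le_joinGraph {Y : Finset V}
    (h : ∀ a ∉ T, ∀ b ∉ T, G.Adj a b → a ∈ Y ∧ b ∈ Y) : G ≤ joinGraph T Y := by
  intro a b hab
  refine ⟨hab.ne, ?_⟩
  by_cases ha : a ∈ T
  · exact Or.inl ha
  by_cases hb : b ∈ T
  · exact Or.inr (Or.inl hb)
  exact Or.inr (Or.inr (h a ha b hb hab))

/-- A sum of truncated differences is bounded through the set where they are positive. -/
theorem sum_sub_le_card_mul {A B : Finset V} {c : ℕ} (hA : ∀ v ∈ A, degIn G H v ≤ c)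
    (hB : ∀ v ∈ A, t < degIn G H v → v ∈ B) :
    ∑ v ∈ A, (degIn G H v ^ 2 - t ^ 2) ≤ B.card * (c ^ 2 - t ^ 2) := by
  rw [← Finset.sum_filter_of_ne (p := fun v => t < degIn G H v)]
  · refine (Finset.sum_le_card_nsmul _ _ (c ^ 2 - t ^ 2) fun v hv => ?_).trans ?_
    · exact Nat.sub_le_sub_right (Nat.pow_le_pow_left (hA v (Finset.mem_filter.1 hv).1) 2) _
    · rw [smul_eq_mul]
      refine Nat.mul_le_mul_right _ (Finset.card_le_card fun v hv => ?_)
      exact hB v (Finset.mem_filter.1 hv).1 (Finset.mem_filter.1 hv).2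
  · intro v _ hv
    by_contra hcon
    exact hv (Nat.sub_eq_zero_of_le (Nat.pow_le_pow_left (not_lt.1 hcon) 2))

variable [Fintype V]

/-- The vertices outside `T` without neighbours in `T`. -/
noncomputable def farFrom (G : SimpleGraph V) (T : Finset V) : Finset V :=
  Finset.univ.filter fun v => v ∉ T ∧ ∀ x ∈ T, ¬ G.Adj v x

theorem mem_farFrom {v : V} : v ∈ farFrom G T ↔ v ∉ T ∧ ∀ x ∈ T, ¬ G.Adj v x := by
  simp [farFrom]

theorem exists_adj_of_notMem_farFrom {v : V} (hv : v ∉ T) (h : v ∉ farFrom G T) :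
    ∃ x ∈ T, G.Adj v x := by
  by_contra hcon
  push Not at hcon
  exact h (mem_farFrom.2 ⟨hv, hcon⟩)

/-- The situation after the hubs `T` have been found: few vertices are far from `T` as soon as the
inner degrees of `H` are small. -/
theorem farFrom_eq_empty {g : ℕ} (ht : 1 ≤ t) (hk₁ : 2 * t + 2 ≤ k) (hk₂ : k ≤ 2 * t + 3)
    (hn : 10 * k ≤ Fintype.card V) (hT : T.card = t) (hg : g ≤ 2 * (2 * t + 1))
    (hE : (Fintype.card V - 1) * ∑ x ∈ T, (Fintype.card V - 1 - degIn G Finset.univ x) ≤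
      (k - 2) * ∑ x ∈ T, (Fintype.card V - 1 - degIn G Finset.univ x) +
        ((farFrom G T).card * ((k - 2) ^ 2 - t ^ 2) + g)) : farFrom G T = ∅ := by
  rw [← Finset.card_eq_zero]
  refine eq_zero_of_mul_le (t := t) (c := k - 2) (N := Fintype.card V - 1) ht (by omega) (by omega)
    (by omega) (Nat.sub_add_cancel (Nat.pow_le_pow_left (by omega) 2)) ?_ hg hE
  rw [← hT]
  refine card_mul_card_le_sum ?_ ?_
  · rw [Finset.disjoint_left]
    exact fun x hx hx' => (mem_farFrom.1 hx').1 hx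
  · exact fun x hx z hz hxz => (mem_farFrom.1 hz).2 x hx hxz.symm

theorem adj_of_sum_eq_zero
    (h : ∑ x ∈ T, (Fintype.card V - 1 - degIn G Finset.univ x) = 0) {x v : V} (hx : x ∈ T)
    (hv : v ≠ x) : G.Adj v x := by
  have h1 := Finset.sum_eq_zero_iff.1 h x hx
  have h2 : Finset.univ.filter (G.Adj x) ⊆ Finset.univ.erase x := fun y hy =>
    Finset.mem_erase.2 ⟨(Finset.mem_filter.1 hy).2.ne', Finset.mem_univ y⟩
  have h3 := Finset.eq_of_subset_of_card_le h2 (by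
    rw [Finset.card_erase_of_mem (Finset.mem_univ x), Finset.card_univ]
    unfold degIn at h1
    omega)
  have h4 : v ∈ Finset.univ.filter (G.Adj x) := by
    rw [h3]; exact Finset.mem_erase.2 ⟨hv, Finset.mem_univ v⟩
  exact (Finset.mem_filter.1 h4).2.symm

/-- Even two vertices ending next to T are too many, so a vertex with a neighbour in T has all its
neighbours there. Only far vertices can then have inner degree above t, and the inequality excludes
them. -/
theorem not_adj_of_hubs_even (ht : 1 ≤ t) (hk : k = 2 * t + 2)
    (hn : 10 * k ≤ Fintype.card V) (hno : ∀ l, PathIn G Finset.univ l → l.length ≠ k)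
    (hT : T.card = t)
    (hcod : ∀ x ∈ T, ∀ y ∈ T, k ≤ (Finset.univ.filter fun z => G.Adj x z ∧ G.Adj y z).card)
    (hH : ∀ v ∈ H, degIn G H v + 2 ≤ k)
    (hE : (Fintype.card V - 1) * ∑ x ∈ T, (Fintype.card V - 1 - degIn G Finset.univ x) ≤
      (k - 2) * ∑ x ∈ T, (Fintype.card V - 1 - degIn G Finset.univ x) +
        ∑ v ∈ H \ T, (degIn G H v ^ 2 - t ^ 2)) :
    ∀ a ∉ T, ∀ b ∉ T, ¬ G.Adj a b := by
  have hnear : ∀ a ∉ T, ∀ b ∉ T, ∀ x ∈ T, G.Adj a x → ¬ G.Adj a b := by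
    intro a ha b hb x hx hax hab
    have := length_add_lt_of_endsNear hcod hno (by omega) [b, a]
      ((PathIn.singleton (by simpa using ha)).cons (by simpa using hb) (by simpa using hab.ne')
        (by simpa using hab.symm)) ((endsNear_singleton hx hax).append (l' := [b]))
    simp only [List.length_cons, List.length_nil] at this
    omega
  have hZ : farFrom G T = ∅ := by
    refine farFrom_eq_empty (g := 0) ht (by omega) (by omega) hn hT (by omega)
      (hE.trans (Nat.add_le_add_left ?_ _))
    refine sum_sub_le_card_mul (fun v hv => ?_) fun v hv hvt => ?_
    · have := hH v (Finset.mem_sdiff.1 hv).1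
      omega
    · by_contra hfar
      obtain ⟨x, hx, hvx⟩ := exists_adj_of_notMem_farFrom (Finset.mem_sdiff.1 hv).2 hfar
      have h1 := degIn_le_degIn_add_card (H := H) (F := ∅)
        (fun y hy hvy => absurd hvy (hnear v (Finset.mem_sdiff.1 hv).2 y hy x hx hvx))
      have h2 := degIn_le_card (G := G) (T := T) (u := v)
      simp only [Finset.card_empty] at h1
      omega
  intro a ha b hb
  obtain ⟨x, hx, hax⟩ := exists_adj_of_notMem_farFrom ha (by rw [hZ]; simp)
  exact hnear a ha b hb x hx hax

/-- Now only three vertices ending next to T are forbidden, so one edge outside T can survive. The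
case split is whether some vertex joined to all of T has exactly one neighbour outside T. -/
theorem exists_pair_of_hubs_odd (ht : 1 ≤ t) (hk : k = 2 * t + 3)
    (hn : 10 * k ≤ Fintype.card V) (hno : ∀ l, PathIn G Finset.univ l → l.length ≠ k)
    (hT : T.card = t)
    (hcod : ∀ x ∈ T, ∀ y ∈ T, k ≤ (Finset.univ.filter fun z => G.Adj x z ∧ G.Adj y z).card)
    (hH : ∀ v ∈ H, degIn G H v + 2 ≤ k)
    (hE : (Fintype.card V - 1) * ∑ x ∈ T, (Fintype.card V - 1 - degIn G Finset.univ x) ≤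
      (k - 2) * ∑ x ∈ T, (Fintype.card V - 1 - degIn G Finset.univ x) +
        ∑ v ∈ H \ T, (degIn G H v ^ 2 - t ^ 2)) :
    ∃ Y : Finset V, Y.card = 2 ∧ Disjoint T Y ∧
      ∀ a ∉ T, ∀ b ∉ T, G.Adj a b → a ∈ Y ∧ b ∈ Y := by
  have hthree : ∀ a ∉ T, ∀ b ∉ T, ∀ c ∉ T, ∀ x ∈ T, G.Adj c x → G.Adj b c → G.Adj a b → a = c := by
    intro a ha b hb c hc x hx hcx hbc hab
    by_contra hac
    have := length_add_lt_of_endsNear hcod hno (by omega) [a, b, c]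
      (((PathIn.singleton (by simpa using hc)).cons (by simpa using hb) (by simpa using hbc.ne)
        (by simpa using hbc)).cons (by simpa using ha) (by simpa using ⟨hab.ne, hac⟩)
        (by simpa using hab)) ((endsNear_singleton hx hcx).append (l' := [a, b]))
    simp only [List.length_cons, List.length_nil] at this
    omega
  have hHk : ∀ v ∈ H \ T, degIn G H v ≤ k - 2 := fun v hv => by
    have := hH v (Finset.mem_sdiff.1 hv).1
    omega
  by_cases hfull : ∃ v ∉ T, (∀ x ∈ T, G.Adj v x) ∧
      ∃ w ∉ T, G.Adj v w ∧ ∀ y ∉ T, G.Adj v y → y = w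
  · obtain ⟨v, hv, hvT, w, hw, hvw, hvnbr⟩ := hfull
    obtain ⟨x₀, hx₀⟩ : T.Nonempty := Finset.card_pos.1 (by omega)
    have hwnbr : ∀ y ∉ T, G.Adj w y → y = v := fun y hy hwy =>
      hthree y hy w hw v hv x₀ hx₀ (hvT x₀ hx₀) hvw.symm hwy.symm
    have hedge : ∀ a ∉ T, ∀ b ∉ T, ∀ x ∈ T, G.Adj a x → G.Adj a b →
        a ∈ ({v, w} : Finset V) ∧ b ∈ ({v, w} : Finset V) := by
      intro a ha b hb x hx hax hab
      simp only [Finset.mem_insert, Finset.mem_singleton]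
      by_cases h1 : a = v
      · exact ⟨Or.inl h1, Or.inr (hvnbr b hb (h1 ▸ hab))⟩
      by_cases h2 : a = w
      · exact ⟨Or.inr h2, Or.inl (hwnbr b hb (h2 ▸ hab))⟩
      by_cases h3 : b = v
      · exact absurd (hvnbr a ha (h3 ▸ hab.symm)) h2
      by_cases h4 : b = w
      · exact absurd (hwnbr a ha (h4 ▸ hab.symm)) h1
      exfalso
      -- The path w, v, through all of T, then a, b has 2 + (2t - 1) + 2 = k vertices. The hub x
      -- comes last because only x is known to be adjacent to a.
      have hmem : ∀ y ∈ (T.erase x).toList ++ [x], y ∈ T := by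
        intro y hy
        rcases List.mem_append.1 hy with hy | hy
        · exact Finset.mem_of_mem_erase (Finset.mem_toList.1 hy)
        · rw [List.mem_singleton] at hy
          exact hy ▸ hx
      have hlen : ((T.erase x).toList ++ [x]).length = t := by
        simp only [List.length_append, Finset.length_toList, List.length_singleton]
        rw [Finset.card_erase_add_one hx, hT]
      obtain ⟨l', hl', hl'len⟩ := exists_path_through (k := k) (G := G)
        (l := (T.erase x).toList ++ [x]) (Q₁ := [w, v]) (Q₂ := [a, b])
        (List.nodup_append.2 ⟨Finset.nodup_toList _, List.nodup_singleton x, by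
          intro y hy z hz hyz
          rw [List.mem_singleton] at hz
          exact Finset.ne_of_mem_erase (Finset.mem_toList.1 hy) (hyz.trans hz)⟩)
        (fun y hy z hz => hcod y (hmem y hy) z (hmem z hz)) (by simp)
        ((PathIn.singleton (Finset.mem_univ v)).cons (Finset.mem_univ w)
          (by simpa using hvw.ne') (by simpa using hvw.symm))
        ((PathIn.singleton (Finset.mem_univ b)).cons (Finset.mem_univ a)
          (by simpa using hab.ne) (by simpa using hab))
        (fun y hy hy' => by
          have := hmem y hy
          simp only [List.mem_cons, List.not_mem_nil, or_false] at hy'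
          rcases hy' with rfl | rfl <;> contradiction)
        (fun y hy hy' => by
          have := hmem y hy
          simp only [List.mem_cons, List.not_mem_nil, or_false] at hy'
          rcases hy' with rfl | rfl <;> contradiction)
        (by simp [Ne.symm h1, Ne.symm h2, Ne.symm h3, Ne.symm h4])
        (by
          intro y hy z hz
          simp only [List.getLast?_cons_cons, List.getLast?_singleton, Option.mem_def,
            Option.some.injEq] at hy
          subst hy
          exact hvT z (hmem z (List.mem_of_mem_head? hz)))
        (by
          intro y hy z hz
          simp only [List.getLast?_append, List.getLast?_singleton, Option.some_or,
            List.head?_cons, Option.mem_def, Option.some.injEq] at hy hz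
          subst hy hz
          exact hax.symm)
        (by simp only [List.length_cons, List.length_nil, hlen]; omega)
      refine hno l' hl' ?_
      simp only [List.length_cons, List.length_nil, hlen] at hl'len
      omega
    have hpair : ∀ u ∈ ({v, w} : Finset V), degIn G H u ≤ t + 1 := by
      intro u hu
      have h2 := degIn_le_card (G := G) (T := T) (u := u)
      rw [Finset.mem_insert, Finset.mem_singleton] at hu
      rcases hu with rfl | rfl
      · have h1 := degIn_le_degIn_add_card (G := G) (H := H) (T := T) (F := {w}) (u := u)
          (fun y hy hy' => by simpa using hvnbr y hy hy')
        rw [Finset.card_singleton] at h1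
        omega
      · have h1 := degIn_le_degIn_add_card (G := G) (H := H) (T := T) (F := {v}) (u := u)
          (fun y hy hy' => by simpa using hwnbr y hy hy')
        rw [Finset.card_singleton] at h1
        omega
    have hZ : farFrom G T = ∅ := by
      -- The vertices v and w have inner degree at most t + 1, each with excess at most (t + 1) ^ 2
      -- - t ^ 2 = 2t + 1.
      refine farFrom_eq_empty (g := 2 * (2 * t + 1)) ht (by omega) (by omega) hn hT le_rfl
        (hE.trans (Nat.add_le_add_left ?_ _))
      rw [← Finset.sum_filter_add_sum_filter_not (H \ T) (· ∈ ({v, w} : Finset V)), add_comm]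
      refine Nat.add_le_add ?_ ?_
      · refine sum_sub_le_card_mul (fun u hu => hHk u (Finset.mem_filter.1 hu).1) ?_
        intro u hu hut
        obtain ⟨hu, huvw⟩ := Finset.mem_filter.1 hu
        have huT := (Finset.mem_sdiff.1 hu).2
        by_contra hfar
        obtain ⟨x, hx, hux⟩ := exists_adj_of_notMem_farFrom huT hfar
        have h1 := degIn_le_degIn_add_card (H := H) (F := ∅)
          (fun y hy huy => absurd (hedge u huT y hy x hx hux huy).1 huvw)
        have h2 := degIn_le_card (G := G) (T := T) (u := u)
        rw [Finset.card_empty] at h1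
        omega
      · refine (Finset.sum_le_card_nsmul _ _ (2 * t + 1) fun u hu => ?_).trans ?_
        · have h1 := Nat.pow_le_pow_left (hpair u (Finset.mem_filter.1 hu).2) 2
          have h2 : (t + 1) ^ 2 = t ^ 2 + (2 * t + 1) := by ring
          omega
        · rw [smul_eq_mul]
          refine Nat.mul_le_mul_right _ ((Finset.card_le_card (t := {v, w}) ?_).trans
            Finset.card_le_two)
          exact fun u hu => (Finset.mem_filter.1 hu).2
    refine ⟨{v, w}, Finset.card_pair hvw.ne, ?_, fun a ha b hb hab => ?_⟩
    · rw [Finset.disjoint_right]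
      intro u hu
      rw [Finset.mem_insert, Finset.mem_singleton] at hu
      rcases hu with rfl | rfl <;> assumption
    · obtain ⟨x, hx, hax⟩ := exists_adj_of_notMem_farFrom ha (by rw [hZ]; simp)
      exact hedge a ha b hb x hx hax hab
  · push Not at hfull
    -- A near vertex v of inner degree above t has two neighbours outside T; neither can see T or
    -- any third vertex outside T. Such a neighbour is a far vertex charged to v, and distinct v get
    -- distinct ones.
    have hleaf : ∀ v ∈ (H \ T).filter (fun v => t < degIn G H v), ∃ w ∈ farFrom G T,
        w = v ∨ ∀ y ∉ T, G.Adj w y ↔ y = v := by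
      intro v hv
      obtain ⟨hv, hvt⟩ := Finset.mem_filter.1 hv
      have hvT := (Finset.mem_sdiff.1 hv).2
      by_cases hfar : v ∈ farFrom G T
      · exact ⟨v, hfar, Or.inl rfl⟩
      obtain ⟨x, hx, hvx⟩ := exists_adj_of_notMem_farFrom hvT hfar
      obtain ⟨w, hw, hvw⟩ : ∃ w ∉ T, G.Adj v w := by
        by_contra hcon
        push Not at hcon
        have h1 := degIn_le_degIn_add_card (H := H) (F := ∅)
          (fun y hy hvy => absurd hvy (hcon y hy))
        have h2 := degIn_le_card (G := G) (T := T) (u := v)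
        rw [Finset.card_empty] at h1
        omega
      obtain ⟨w', hw', hvw', hne⟩ : ∃ w' ∉ T, G.Adj v w' ∧ w' ≠ w := by
        by_contra hcon
        push Not at hcon
        have h1 := degIn_le_degIn_add_card (G := G) (T := T) (H := H) (F := {w}) (u := v)
          (fun y hy hvy => by simpa using hcon y hy hvy)
        rw [Finset.card_singleton] at h1
        obtain ⟨y, hy, hvy, hyw⟩ := hfull v hvT
          (fun x hx => adj_of_degIn_eq_card (by omega) hx) w hw hvw
        exact hyw (hcon y hy hvy)
      refine ⟨w, mem_farFrom.2 ⟨hw, fun z hz hwz => ?_⟩, Or.inr fun y hy => ⟨fun hwy => ?_, ?_⟩⟩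
      · exact hne (hthree w' hw' v hvT w hw z hz hwz hvw hvw'.symm)
      · exact hthree y hy w hw v hvT x hx hvx hvw.symm hwy.symm
      · rintro rfl
        exact hvw.symm
    have hZ : farFrom G T = ∅ := by
      refine farFrom_eq_empty (g := 0) ht (by omega) (by omega) hn hT (by omega)
        (hE.trans (Nat.add_le_add_left ?_ _))
      refine (sum_sub_le_card_mul (B := (H \ T).filter fun v => t < degIn G H v) hHk
        fun v hv hvt => Finset.mem_filter.2 ⟨hv, hvt⟩).trans (Nat.mul_le_mul_right _ ?_)
      choose! φ hφ hφ' using hleaf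
      -- A far vertex charged to itself cannot also be a leaf charged to another, since a leaf has
      -- degree 1 ≤ t.
      have hno_leaf : ∀ u ∈ (H \ T).filter (fun v => t < degIn G H v), u ∈ farFrom G T →
          ∀ v, ¬ ∀ y ∉ T, G.Adj u y ↔ y = v := by
        intro u hu hfar v hall
        have hut := (Finset.mem_filter.1 hu).2
        have h1 := degIn_le_degIn_add_card (G := G) (H := H) (T := T) (F := {v}) (u := u)
          (fun y hy huy => by simpa using (hall y hy).1 huy)
        have h2 : degIn G T u = 0 := by
          unfold degIn
          rw [Finset.card_eq_zero, Finset.filter_eq_empty_iff]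
          exact fun x hx => (mem_farFrom.1 hfar).2 x hx
        rw [Finset.card_singleton] at h1
        omega
      refine Finset.card_le_card_of_injOn φ (fun v hv => hφ v hv) ?_
      intro a ha b hb hab
      have ha2 := hφ a ha
      have hb2 := hφ b hb
      rcases hφ' a ha with h1 | h1 <;> rcases hφ' b hb with h2 | h2
      · exact h1.symm.trans (hab.trans h2)
      · rw [← hab, h1] at h2
        rw [h1] at ha2
        exact absurd h2 (hno_leaf a ha ha2 b)
      · rw [hab, h2] at h1
        rw [h2] at hb2
        exact absurd h1 (hno_leaf b hb hb2 a)
      · have haT := (Finset.mem_sdiff.1 (Finset.mem_filter.1 ha).1).2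
        have h3 := (h1 a haT).2 rfl
        rw [hab] at h3
        exact (h2 a haT).1 h3
    have hE0 : ∑ v ∈ H \ T, (degIn G H v ^ 2 - t ^ 2) ≤ 0 := by
      refine (sum_sub_le_card_mul (B := ∅) hHk fun v hv hvt => ?_).trans (by simp)
      obtain ⟨w, hw, -⟩ := hleaf v (Finset.mem_filter.2 ⟨hv, hvt⟩)
      rw [hZ] at hw
      simp at hw
    -- With no excess left, N q ≤ (k - 2) q forces q = 0, so every hub is adjacent to all other
    -- vertices.
    have hq : ∑ x ∈ T, (Fintype.card V - 1 - degIn G Finset.univ x) = 0 := by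
      by_contra hq0
      have h1 := Nat.mul_lt_mul_of_pos_right (show k - 2 < Fintype.card V - 1 by omega)
        (Nat.pos_of_ne_zero hq0)
      omega
    have hnone : ∀ a ∉ T, ∀ b ∉ T, ¬ G.Adj a b := by
      intro a ha b hb hab
      have hall : ∀ v ∉ T, ∀ x ∈ T, G.Adj v x := fun v hv x hx =>
        adj_of_sum_eq_zero hq hx fun h => hv (h ▸ hx)
      obtain ⟨x, hx⟩ : T.Nonempty := Finset.card_pos.1 (by omega)
      obtain ⟨y, hy, hay, hyb⟩ := hfull a ha (hall a ha) b hb hab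
      exact hyb (hthree y hy a ha b hb x hx (hall b hb x hx) hab hay.symm)
    obtain ⟨Y, hYT, hY⟩ := Finset.exists_subset_card_eq (s := Tᶜ) (n := 2)
      (by rw [Finset.card_compl]; omega)
    refine ⟨Y, hY, ?_, fun a ha b hb hab => absurd hab (hnone a ha b hb)⟩
    rw [Finset.disjoint_right]
    exact fun y hy => Finset.mem_compl.1 (hYT hy)

end Structure

/-! ### Assembly of the theorem. -/

theorem theorem2 (k n : ℕ) (hk : 4 ≤ k) (p : ℝ) (hp : 2 ≤ p) (hn : 10 * k ≤ n)
    {V : Type*} [Fintype V] (hV : Fintype.card V = n) (G : SimpleGraph V)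
    (hG : IsMaxPathFree k p G) :
    Nonempty (G ≃g graphW n (k - 1) (k / 2 - 1)) := by
  classical
  subst hV
  obtain ⟨t, ht⟩ : ∃ t, t = k / 2 - 1 := ⟨_, rfl⟩
  rw [← ht]
  obtain ⟨hfree, hmax⟩ := hG
  have hno := pathFree_iff.1 hfree
  have hW : ∀ T Y : Finset V, T.card = t → Y.card = k - 1 - 2 * t →
      degreePowerSum p (joinGraph T Y) ≤ degreePowerSum p G := fun T Y hT hY =>
    hmax _ (pathFree_joinGraph (by omega) (by omega))
  obtain ⟨T, hT, hcod, H, hH, hE⟩ := exists_hubs (t := t) (by omega) (by omega) (by omega) hn hno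
    (by
      intro T hT hlow
      rw [← hT]
      refine sum_sq_sub_sq_le hp (by omega) T _ (fun v => ?_) hlow ?_
      · have := degIn_add_one_le_card (G := G) (Finset.mem_univ v)
        rw [Finset.card_univ] at this
        omega
      -- Y may meet T here: neither path-freeness nor the lower bound needs disjointness.
      · obtain ⟨Y, -, hY⟩ := Finset.exists_subset_card_eq (s := (Finset.univ : Finset V))
          (n := k - 1 - 2 * t) (by rw [Finset.card_univ]; omega)
        rw [← degreePowerSum_eq_sum_degIn]
        exact (le_degreePowerSum_joinGraph (by linarith) T Y).trans (hW T Y hT hY))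
  obtain ⟨Y, hY, hTY, hedge⟩ : ∃ Y : Finset V, Y.card = k - 1 - 2 * t ∧ Disjoint T Y ∧
      ∀ a ∉ T, ∀ b ∉ T, G.Adj a b → a ∈ Y ∧ b ∈ Y := by
    rcases Nat.even_or_odd' k with ⟨m, hm | hm⟩
    · have hnone := not_adj_of_hubs_even (t := t) (by omega) (by omega) hn hno hT hcod hH hE
      obtain ⟨Y, hYT, hY⟩ := Finset.exists_subset_card_eq (s := Tᶜ) (n := 1)
        (by rw [Finset.card_compl]; omega)
      refine ⟨Y, by omega, ?_, fun a ha b hb hab => absurd hab (hnone a ha b hb)⟩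
      rw [Finset.disjoint_right]
      exact fun y hy => Finset.mem_compl.1 (hYT hy)
    · obtain ⟨Y, hY, h⟩ := exists_pair_of_hubs_odd (t := t) (by omega) (by omega) hn hno hT hcod
        hH hE
      exact ⟨Y, by omega, h⟩
  have hle : G ≤ joinGraph T Y := le_joinGraph hedge
  -- A proper subgraph of the P_k-free join would have a strictly smaller degree power sum.
  have heq : G = joinGraph T Y := by
    by_contra hne
    exact absurd (hW T Y hT hY)
      (not_le.2 (degreePowerSum_lt_of_lt (by linarith) (lt_of_le_of_ne hle hne)))
  rw [heq, ← hT]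
  exact nonempty_joinGraph_iso rfl (by omega) (by omega) hTY
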